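/- Let $\varphi:\mathbb R^2\to\mathbb R$ be a smooth function that equals $1$ on $B(0,2/3)$ and vanishes outside $B(0,3/2)$, put $\varphi_k(\xi)=\varphi(\xi/2^k)-\varphi(\xi/2^{k-1})$ for $k\in\mathbb Z$, and let $M\ge 10$ be an integer. For $R>0$ consider complex-valued functions on the torus $(\mathbb R/R\mathbb Z)^2$ with Lebesgue measure, and put $$\hat u(\xi)=R^{-2}\int_{(\mathbb R/R\mathbb Z)^2} e^{-ix\cdot\xi}u(x)\,dx,\qquad \xi\in(2\pi\mathbb Z/R)^2 .$$ Let $P_k$ and $e^{-is\Lambda}$ be the Fourier multipliers with symbols $\varphi_k(\xi)$ and $e^{-is\sqrt{1+|\xi|^2}}$ respectively, and let $$\|u\|_X=\sum_{k\in\mathbb Z}2^{M\max(k,0)}\|P_ku\|_{L^\infty},\qquad \|u\|_{H^{M+2}}=\Big(R^2\sum_{\xi\in(2\pi\mathbb Z/R)^2}(1+|\xi|^2)^{M+2}|\hat u(\xi)|^2\Big)^{1/2}.$$ Then there is a constant $C>0$, depending only on $M$ and $\varphi$, such that for all $R\ge 2$, all $t\ge 0$ and all $u\in H^{M+2}((\mathbb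 R/R\mathbb Z)^2)$, $$\Big(\int_0^t\|e^{-is\Lambda}u\|_X^2\,ds\Big)^{1/2}\le C\,\log R\,\sqrt{1+t/R}\;\|u\|_{H^{M+2}} .$$ -/

import Mathlib

open MeasureTheory
open scoped ENNReal ContDiff ComplexConjugate

noncomputable section

namespace KleinGordonTorus

/-- The square torus `(ℝ/Rℤ)²`. For `R > 0` it carries Lebesgue measure, of total mass `R²`. -/
abbrev Torus (R : ℝ) : Type := Fin 2 → AddCircle R

/-- The frequency plane `ℝ²` with its Euclidean norm. -/
abbrev Freq : Type := EuclideanSpace ℝ (Fin 2)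

/-- The point `ξ = 2πn/R` of the frequency lattice `(2πℤ/R)²`. -/
def freq (R : ℝ) (n : Fin 2 → ℤ) : Freq :=
  WithLp.toLp 2 fun i => 2 * Real.pi * (n i : ℝ) / R

/-- The character `x ↦ exp (i x · ξ)`, `ξ = 2πn/R`, of the torus. -/
def character (R : ℝ) (n : Fin 2 → ℤ) : C(Torus R, ℂ) where
  toFun x := ∏ i, fourier (n i) (x i)
  continuous_toFun := by fun_prop

variable {R : ℝ} [Fact (0 < R)]

/-- The space `L²((ℝ/Rℤ)²; ℂ)`, with respect to Lebesgue measure. -/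
abbrev L2 (R : ℝ) [Fact (0 < R)] : Type := Lp ℂ 2 (volume : Measure (Torus R))

/-- The character as an element of `L²`. -/
def characterL2 (R : ℝ) [Fact (0 < R)] (n : Fin 2 → ℤ) : L2 R :=
  ContinuousMap.toLp 2 (volume : Measure (Torus R)) ℂ (character R n)

/-- The Fourier coefficient `R⁻² ∫ exp (-i x · ξ) u(x) dx`, `ξ = 2πn/R`. -/
def coeff (u : L2 R) (n : Fin 2 → ℤ) : ℂ :=
  ((R : ℂ) ^ 2)⁻¹ * ∫ x : Torus R, conj (character R n x) * u x

/-- The Fourier multiplier with symbol `m`, that is `u ↦ ∑_ξ m(ξ) û(ξ) exp (i x · ξ)`, where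
the series converges (unconditionally) in `L²`. It is used for bounded symbols only, for
which the series does converge, see `hasSum_multiplier` below. -/
def multiplier (m : Freq → ℂ) (u : L2 R) : L2 R :=
  ∑' n : Fin 2 → ℤ, (m (freq R n) * coeff u n) • characterL2 R n

theorem inner_characterL2 (m n : Fin 2 → ℤ) :
    inner ℂ (characterL2 R m) (characterL2 R n) = if m = n then (R : ℂ) ^ 2 else 0 := by
  have h1 : ∀ a b : ℤ, ∫ x : AddCircle R, conj (fourier a x) * fourier b x =
      if a = b then (R : ℂ) else 0 := by
    intro a b
    have h := (orthonormal_iff_ite.mp (orthonormal_fourier (T := R))) a b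
    rw [ContinuousMap.inner_toLp (𝕜 := ℂ) AddCircle.haarAddCircle (fourier a) (fourier b)] at h
    rw [AddCircle.volume_eq_smul_haarAddCircle, integral_smul_measure,
      ENNReal.toReal_ofReal (Fact.out : 0 < R).le]
    simp only [mul_comm (conj _)]
    rw [h]
    split_ifs <;> simp
  rw [characterL2, characterL2, ContinuousMap.inner_toLp]
  have h2 : ∀ x : Torus R, character R n x * conj (character R m x) =
      ∏ i, (conj (fourier (m i) (x i)) * fourier (n i) (x i)) := by
    intro x
    simp [character, Finset.prod_mul_distrib, mul_comm]
  simp only [h2]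
  rw [integral_fintype_prod_volume_eq_prod (𝕜 := ℂ)
    (f := fun i (y : AddCircle R) => conj (fourier (m i) y) * fourier (n i) y)]
  simp only [h1]
  by_cases hmn : m = n
  · simp [hmn]
  · rw [if_neg hmn]
    obtain ⟨i, hi⟩ := Function.ne_iff.mp hmn
    exact Finset.prod_eq_zero (Finset.mem_univ i) (if_neg hi)

theorem inner_characterL2_left (n : Fin 2 → ℤ) (u : L2 R) :
    inner ℂ (characterL2 R n) u = (R : ℂ) ^ 2 * coeff u n := by
  have hR : (R : ℂ) ≠ 0 := by exact_mod_cast (Fact.out : 0 < R).ne'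
  rw [coeff, mul_inv_cancel_left₀ (pow_ne_zero 2 hR), L2.inner_def]
  refine integral_congr_ae ?_
  filter_upwards [ContinuousMap.coeFn_toLp (p := 2) (𝕜 := ℂ) (volume : Measure (Torus R))
    (character R n)] with x hx
  rw [characterL2, hx, RCLike.inner_apply, mul_comm]

/-- For a bounded symbol, the series that defines the multiplier converges in `L²`. -/
theorem hasSum_multiplier {m : Freq → ℂ} {B : ℝ} (hm : ∀ ξ, ‖m ξ‖ ≤ B) (u : L2 R) :
    HasSum (fun n : Fin 2 → ℤ => (m (freq R n) * coeff u n) • characterL2 R n)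
      (multiplier m u) := by
  have hR : 0 < R := Fact.out
  have hRc : (R : ℂ) ≠ 0 := by exact_mod_cast hR.ne'
  have ho : Orthonormal ℂ (fun n => (R : ℂ)⁻¹ • characterL2 R n) := by
    rw [orthonormal_iff_ite]
    intro i j
    rw [inner_smul_left, inner_smul_right, inner_characterL2]
    split_ifs
    · simp only [map_inv₀, Complex.conj_ofReal]
      field_simp
    · simp
  refine Summable.hasSum ?_
  have hs := ho.inner_products_summable (x := u)
  have key := (ho.orthogonalFamily.summable_iff_norm_sq_summable
    (fun n => (m (freq R n) * coeff u n * R : ℂ))).mpr ?_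
  · refine key.congr fun n => ?_
    simp only [LinearIsometry.toSpanSingleton_apply, smul_smul]
    rw [mul_assoc, mul_inv_cancel₀ hRc, mul_one]
  · refine Summable.of_nonneg_of_le (fun _ => by positivity) (fun n => ?_) (hs.mul_left (B ^ 2))
    rw [inner_smul_left, inner_characterL2_left, ← mul_pow]
    have e : conj ((R : ℂ)⁻¹) * ((R : ℂ) ^ 2 * coeff u n) = coeff u n * R := by
      simp only [map_inv₀, Complex.conj_ofReal]
      field_simp
    rw [e, mul_assoc, norm_mul]
    gcongr
    exact hm _

/-- For a bounded symbol, the multiplier acts on Fourier coefficients as it should. -/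
theorem coeff_multiplier {m : Freq → ℂ} {B : ℝ} (hm : ∀ ξ, ‖m ξ‖ ≤ B) (u : L2 R)
    (n : Fin 2 → ℤ) : coeff (multiplier m u) n = m (freq R n) * coeff u n := by
  have hRc : (R : ℂ) ^ 2 ≠ 0 := pow_ne_zero 2 (by exact_mod_cast (Fact.out : 0 < R).ne')
  have h := (hasSum_multiplier hm u).mapL (innerSL ℂ (characterL2 R n))
  simp only [innerSL_apply_apply, inner_smul_right, inner_characterL2] at h
  rw [inner_characterL2_left] at h
  have h' := hasSum_single (f := fun b => m (freq R b) * coeff u b *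
    if n = b then (R : ℂ) ^ 2 else 0) n (fun b hb => by rw [if_neg hb.symm, mul_zero])
  have := h.unique h'
  rw [if_pos rfl, mul_comm] at this
  exact mul_right_cancel₀ hRc this

/-- The symbol `Λ(ξ) = √(1 + |ξ|²)`. -/
def bracket (ξ : Freq) : ℝ := Real.sqrt (1 + ‖ξ‖ ^ 2)

/-- The Klein-Gordon propagator `exp (-isΛ)`. -/
def flow (s : ℝ) (u : L2 R) : L2 R :=
  multiplier (fun ξ => Complex.exp (-Complex.I * s * bracket ξ)) u

/-- `φ` is a smooth cutoff function, equal to `1` on `B(0, 2/3)` and to `0` outside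
`B(0, 3/2)`. -/
structure IsCutoff (φ : Freq → ℝ) : Prop where
  smooth : ContDiff ℝ ∞ φ
  eq_one : ∀ ξ ∈ Metric.ball (0 : Freq) (2 / 3), φ ξ = 1
  eq_zero : ∀ ξ ∉ Metric.ball (0 : Freq) (3 / 2), φ ξ = 0

/-- `φ_k(ξ) = φ(ξ / 2^k) - φ(ξ / 2^(k-1))`. -/
def dyadic (φ : Freq → ℝ) (k : ℤ) (ξ : Freq) : ℝ :=
  φ (((2 : ℝ) ^ k)⁻¹ • ξ) - φ (((2 : ℝ) ^ (k - 1))⁻¹ • ξ)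

/-- The Littlewood-Paley projection `P_k`. -/
def proj (φ : Freq → ℝ) (k : ℤ) (u : L2 R) : L2 R :=
  multiplier (fun ξ => (dyadic φ k ξ : ℂ)) u

/-- `‖u‖_X = ∑_{k ∈ ℤ} 2^{M k⁺} ‖P_k u‖_{L^∞}`, with `k⁺ = max k 0`, as an element of
`[0, ∞]`. -/
def normX (φ : Freq → ℝ) (M : ℕ) (u : L2 R) : ℝ≥0∞ :=
  ∑' k : ℤ, (2 : ℝ≥0∞) ^ (M * (max k 0).toNat) *
    eLpNorm (proj φ k u) ∞ (volume : Measure (Torus R))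

/-- `‖u‖_{H^s} = (R² ∑_ξ (1 + |ξ|²)^s |û(ξ)|²)^{1/2}`, as an element of `[0, ∞]`; by
Plancherel's theorem this is `‖Λ^s u‖_{L²}`. The space `H^s` consists of the `u` in `L²`
for which it is finite. -/
def normH (s : ℕ) (u : L2 R) : ℝ≥0∞ :=
  (∑' n : Fin 2 → ℤ,
    ENNReal.ofReal (R ^ 2 * (1 + ‖freq R n‖ ^ 2) ^ s * ‖coeff u n‖ ^ 2)) ^ (1 / 2 : ℝ)

end KleinGordonTorus

end

/-!
The proof is a `TT*` argument on time intervals of length `R`, made elementary by a good choice of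
weight. Every `P_k exp (-isΛ) u` is a trigonometric polynomial, with frequencies `|ξ| ~ 2^k`, so
its coefficients may be compared with the weight `w(ξ) = exp (-εΛ(ξ)) / Λ(ξ)`, `ε = 2^(-max k 0)`,
at the cost of `1 / w ≤ C 2^(max k 0)`. The kernel of the resulting `TT*` operator is
`∑_ξ exp (i x · ξ) exp (-zΛ(ξ)) / Λ(ξ)` with `z = ε + is`, which is explicit: subordination to the
Gaussian and Poisson summation give, for real `z > 0`,

  `∑_ξ exp (i x · ξ) exp (-zΛ(ξ)) / Λ(ξ) = (R² / 2π) ∑_m exp (-ζ_m) / ζ_m`,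
  `ζ_m = √(z² + |x - Rm|²)`,

and both sides are holomorphic in `Re z > 0` (`tsum_planeWave_mul_exp`). The dispersive decay
`|exp (-ζ) / ζ| ≤ C / (ε (1 + |s|))` follows from `Re ζ · Im ζ = Re z · Im z = εs` and `Re ζ ≥ ε`
(`norm_green_le`), with no stationary phase; since also `Re ζ_m ≥ |x - Rm| - |s|`, the sum over the
images `m` satisfies the same bound as long as `|s| ≤ R` (`exists_norm_tsum_planeWave_le`).

Integrating `1 / (1 + |s|)` over `|s| ≤ R` costs a factor `log R`, and covering `[0, t]` by
intervals of length `R` costs `1 + t / R`; this is the estimate for one Littlewood-Paley piece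
(`IsCutoff.exists_strichartz`). It loses `2^k` at high frequency, and the regularity `M + 2`
leaves a further `2^(-k)` to sum the pieces with `k ≥ 0`. As the frequency lattice has spacing
`2π / R` and `P_k` annihilates constants, only about `log R` pieces with `k < 0` are nonzero, so
that the Cauchy-Schwarz inequality in `k` costs the second factor `log R`
(`tsum_dyadic_weight_le`) in the square of the estimate.
-/

namespace KleinGordonTorus

/-! ### Subordination integrals -/

theorem image_mul_sub_div_Ioi {p q : ℝ} (hp : 0 < p) (hq : 0 < q) :
    (fun y : ℝ => p * y - q / y) '' Set.Ioi 0 = Set.univ := by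
  refine Set.eq_univ_of_forall fun u => ?_
  have h : |u| < Real.sqrt (u ^ 2 + 4 * p * q) := by
    rw [← Real.sqrt_sq_eq_abs]
    exact Real.sqrt_lt_sqrt (sq_nonneg u) (by nlinarith [mul_pos hp hq])
  have hs : Real.sqrt (u ^ 2 + 4 * p * q) ^ 2 = u ^ 2 + 4 * p * q :=
    Real.sq_sqrt (by nlinarith [mul_pos hp hq, sq_nonneg u])
  set r := Real.sqrt (u ^ 2 + 4 * p * q)
  have hpos : 0 < u + r := by linarith [neg_abs_le u]
  refine ⟨(u + r) / (2 * p), div_pos hpos (by positivity), ?_⟩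
  field_simp
  nlinarith

theorem injOn_mul_sub_div {p q : ℝ} (hp : 0 < p) (hq : 0 < q) :
    Set.InjOn (fun y : ℝ => p * y - q / y) (Set.Ioi 0) := by
  refine StrictMonoOn.injOn fun x hx y hy hxy => ?_
  have hx' : 0 < x := hx
  have := div_lt_div_of_pos_left hq hx' hxy
  have := mul_lt_mul_of_pos_left hxy hp
  linarith

/-- The change of variables `u = p y - q / y` turns this into the Gaussian integral. -/
theorem integral_add_div_sq_mul_exp {p q : ℝ} (hp : 0 < p) (hq : 0 < q) :
    IntegrableOn (fun y : ℝ => (p + q / y ^ 2) * Real.exp (-((p * y) ^ 2 + (q / y) ^ 2)))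
      (Set.Ioi 0) ∧
    ∫ y in Set.Ioi (0 : ℝ), (p + q / y ^ 2) * Real.exp (-((p * y) ^ 2 + (q / y) ^ 2)) =
      Real.sqrt Real.pi * Real.exp (-(2 * p * q)) := by
  have hd : ∀ y ∈ Set.Ioi (0 : ℝ),
      HasDerivWithinAt (fun y : ℝ => p * y - q / y) (p + q / y ^ 2) (Set.Ioi 0) y := by
    intro y hy
    have hy0 : y ≠ 0 := ne_of_gt hy
    have := ((hasDerivAt_id y).const_mul p).sub ((hasDerivAt_inv hy0).const_mul q)
    refine (this.congr_deriv ?_).hasDerivWithinAt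
    field_simp
    ring
  have heq : ∀ y ∈ Set.Ioi (0 : ℝ),
      |p + q / y ^ 2| • Real.exp (-1 * (p * y - q / y) ^ 2) =
        Real.exp (2 * p * q) *
          ((p + q / y ^ 2) * Real.exp (-((p * y) ^ 2 + (q / y) ^ 2))) := by
    intro y hy
    have hy0 : (0 : ℝ) < y := hy
    rw [abs_of_pos (by positivity), smul_eq_mul, mul_left_comm, ← Real.exp_add]
    congr 2
    field_simp
    ring
  have hI := (integrableOn_image_iff_integrableOn_abs_deriv_smul measurableSet_Ioi hd
    (injOn_mul_sub_div hp hq) (fun u => Real.exp (-1 * u ^ 2))).mp (by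
      rw [image_mul_sub_div_Ioi hp hq, integrableOn_univ]
      exact integrable_exp_neg_mul_sq one_pos)
  have hV := integral_image_eq_integral_abs_deriv_smul measurableSet_Ioi hd
    (injOn_mul_sub_div hp hq) (fun u => Real.exp (-1 * u ^ 2))
  rw [image_mul_sub_div_Ioi hp hq, Measure.restrict_univ, integral_gaussian, div_one,
    setIntegral_congr_fun measurableSet_Ioi heq, integral_const_mul] at hV
  rw [integrableOn_congr_fun heq measurableSet_Ioi] at hI
  refine ⟨?_, ?_⟩
  · refine IntegrableOn.congr_fun (hI.const_mul (Real.exp (-(2 * p * q)))) (fun y _ => ?_)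
      measurableSet_Ioi
    rw [← mul_assoc, ← Real.exp_add, neg_add_cancel, Real.exp_zero, one_mul]
  · rw [hV, mul_comm, ← mul_assoc, ← Real.exp_add, neg_add_cancel, Real.exp_zero, one_mul]

/-- The substitution `y ↦ q / (p y)` exchanges the two summands of the previous integral. -/
theorem integral_exp_neg_sq_add_inv_sq_symm {p q : ℝ} (hp : 0 < p) (hq : 0 < q) :
    p * ∫ y in Set.Ioi (0 : ℝ), Real.exp (-((p * y) ^ 2 + (q / y) ^ 2)) =
      q * ∫ y in Set.Ioi (0 : ℝ), (y ^ 2)⁻¹ * Real.exp (-((p * y) ^ 2 + (q / y) ^ 2)) := by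
  have hd : ∀ y ∈ Set.Ioi (0 : ℝ),
      HasDerivWithinAt (fun y : ℝ => q / p / y) (-(q / p / y ^ 2)) (Set.Ioi 0) y := by
    intro y hy
    have hy0 : y ≠ 0 := ne_of_gt hy
    refine (((hasDerivAt_inv hy0).const_mul (q / p)).congr_deriv ?_).hasDerivWithinAt
    ring
  have hqp : 0 < q / p := div_pos hq hp
  have hinj : Set.InjOn (fun y : ℝ => q / p / y) (Set.Ioi 0) := by
    refine StrictAntiOn.injOn fun x hx y hy hxy => ?_
    exact div_lt_div_of_pos_left hqp hx hxy
  have him : (fun y : ℝ => q / p / y) '' Set.Ioi 0 = Set.Ioi 0 := by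
    ext u
    constructor
    · rintro ⟨y, hy, rfl⟩
      exact div_pos hqp hy
    · intro hu
      refine ⟨q / p / u, div_pos hqp hu, ?_⟩
      exact div_div_cancel₀ hqp.ne'
  have hV := integral_image_eq_integral_abs_deriv_smul measurableSet_Ioi hd hinj
    (fun y => Real.exp (-((p * y) ^ 2 + (q / y) ^ 2)))
  rw [him] at hV
  rw [hV, ← integral_const_mul, ← integral_const_mul]
  refine setIntegral_congr_fun measurableSet_Ioi fun y hy => ?_
  have hy0 : (0 : ℝ) < y := hy
  rw [abs_neg, abs_of_pos (by positivity), smul_eq_mul]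
  have : -((p * (q / p / y)) ^ 2 + (q / (q / p / y)) ^ 2) = -((p * y) ^ 2 + (q / y) ^ 2) := by
    field_simp
    ring
  rw [this]
  field_simp

theorem integrableOn_exp_neg_sq_add_inv_sq {p q : ℝ} (hp : 0 < p) (hq : 0 < q) :
    IntegrableOn (fun y : ℝ => Real.exp (-((p * y) ^ 2 + (q / y) ^ 2))) (Set.Ioi 0) := by
  refine Integrable.mono' ((integral_add_div_sq_mul_exp hp hq).1.const_mul p⁻¹)
    (by fun_prop) ?_
  refine (ae_restrict_mem measurableSet_Ioi).mono fun y hy => ?_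
  have hy0 : (0 : ℝ) < y := hy
  rw [Real.norm_of_nonneg (Real.exp_pos _).le, ← mul_assoc]
  refine le_mul_of_one_le_left (Real.exp_pos _).le ?_
  rw [mul_add, inv_mul_cancel₀ hp.ne']
  have : 0 ≤ p⁻¹ * (q / y ^ 2) := by positivity
  linarith

theorem integrableOn_inv_sq_mul_exp_neg_sq_add_inv_sq {p q : ℝ} (hp : 0 < p) (hq : 0 < q) :
    IntegrableOn (fun y : ℝ => (y ^ 2)⁻¹ * Real.exp (-((p * y) ^ 2 + (q / y) ^ 2)))
      (Set.Ioi 0) := by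
  refine Integrable.mono' ((integral_add_div_sq_mul_exp hp hq).1.const_mul q⁻¹)
    (by fun_prop) ?_
  refine (ae_restrict_mem measurableSet_Ioi).mono fun y hy => ?_
  have hy0 : (0 : ℝ) < y := hy
  rw [Real.norm_of_nonneg (by positivity), ← mul_assoc]
  gcongr
  rw [mul_add, ← mul_div_assoc, inv_mul_cancel₀ hq.ne', one_div]
  have : 0 ≤ q⁻¹ * p := by positivity
  linarith

theorem integral_exp_neg_sq_add_inv_sq {p q : ℝ} (hp : 0 < p) (hq : 0 < q) :
    ∫ y in Set.Ioi (0 : ℝ), Real.exp (-((p * y) ^ 2 + (q / y) ^ 2)) =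
        Real.sqrt Real.pi / (2 * p) * Real.exp (-(2 * p * q)) ∧
    ∫ y in Set.Ioi (0 : ℝ), (y ^ 2)⁻¹ * Real.exp (-((p * y) ^ 2 + (q / y) ^ 2)) =
        Real.sqrt Real.pi / (2 * q) * Real.exp (-(2 * p * q)) := by
  have h1 := (integral_add_div_sq_mul_exp hp hq).2
  have h2 := integral_exp_neg_sq_add_inv_sq_symm hp hq
  have h3 : ∀ y : ℝ, (p + q / y ^ 2) * Real.exp (-((p * y) ^ 2 + (q / y) ^ 2)) =
      p * Real.exp (-((p * y) ^ 2 + (q / y) ^ 2)) +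
        q * ((y ^ 2)⁻¹ * Real.exp (-((p * y) ^ 2 + (q / y) ^ 2))) := fun y => by ring
  simp only [h3] at h1
  rw [integral_add ((integrableOn_exp_neg_sq_add_inv_sq hp hq).const_mul p)
    ((integrableOn_inv_sq_mul_exp_neg_sq_add_inv_sq hp hq).const_mul q),
    integral_const_mul, integral_const_mul] at h1
  generalize (∫ y in Set.Ioi (0 : ℝ), Real.exp (-((p * y) ^ 2 + (q / y) ^ 2))) = A at *
  generalize (∫ y in Set.Ioi (0 : ℝ),
    (y ^ 2)⁻¹ * Real.exp (-((p * y) ^ 2 + (q / y) ^ 2))) = B at *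
  rw [div_mul_eq_mul_div, div_mul_eq_mul_div, eq_div_iff (by positivity),
    eq_div_iff (by positivity)]
  constructor <;> linarith

/-! ### The fundamental solution -/

/-- The principal square root `√(z² + q)`. -/
noncomputable def root (z : ℂ) (q : ℝ) : ℂ := (z ^ 2 + q) ^ (1 / 2 : ℂ)

/-- The kernel `exp (-√(z² + |x|²)) / √(z² + |x|²)`, as a function of `z` and of `q = |x|²`.
Up to the factor `2π`, it is the inverse Fourier transform of `exp (-zΛ) / Λ` on `ℝ²`. -/
noncomputable def green (z : ℂ) (q : ℝ) : ℂ := Complex.exp (-root z q) / root z q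

theorem sq_add_mem_slitPlane {z : ℂ} (hz : 0 < z.re) {q : ℝ} (hq : 0 ≤ q) :
    z ^ 2 + q ∈ Complex.slitPlane := by
  rw [Complex.mem_slitPlane_iff]
  by_cases h : z.im = 0
  · left
    simp [pow_two, h]
    positivity
  · right
    simp [pow_two]
    intro h'
    have : z.re * z.im = 0 := by linarith
    simp [h, hz.ne'] at this

theorem root_sq (z : ℂ) (q : ℝ) : root z q ^ 2 = z ^ 2 + q := by
  rw [root, one_div]
  exact Complex.cpow_nat_inv_pow _ two_ne_zero

theorem re_root_pos {z : ℂ} (hz : 0 < z.re) {q : ℝ} (hq : 0 ≤ q) : 0 < (root z q).re := by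
  have hs := sq_add_mem_slitPlane hz hq
  have h0 : z ^ 2 + q ≠ 0 := Complex.slitPlane_ne_zero hs
  rw [root, Complex.cpow_def_of_ne_zero h0, Complex.exp_re]
  refine mul_pos (Real.exp_pos _) (Real.cos_pos_of_mem_Ioo ?_)
  have h1 := Complex.neg_pi_lt_arg (z ^ 2 + q)
  have h2 := lt_of_le_of_ne (Complex.arg_le_pi (z ^ 2 + q)) (Complex.mem_slitPlane_iff_arg.mp hs).1
  have : (Complex.log (z ^ 2 + q) * (1 / 2 : ℂ)).im = Complex.arg (z ^ 2 + q) / 2 := by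
    rw [show (1 / 2 : ℂ) = ((1 / 2 : ℝ) : ℂ) by push_cast; rfl, Complex.im_mul_ofReal,
      Complex.log_im]
    ring
  rw [this]
  constructor <;> linarith

theorem root_ofReal {z : ℝ} (q : ℝ) (hq : 0 ≤ z ^ 2 + q) :
    root z q = (Real.sqrt (z ^ 2 + q) : ℂ) := by
  rw [root, Real.sqrt_eq_rpow, Complex.ofReal_cpow hq]
  push_cast
  rfl

theorem re_mul_im_root (z : ℂ) (q : ℝ) :
    (root z q).re * (root z q).im = z.re * z.im := by
  have := congrArg Complex.im (root_sq z q)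
  simp [pow_two] at this
  linarith

theorem re_sq_sub_im_sq_root (z : ℂ) (q : ℝ) :
    (root z q).re ^ 2 - (root z q).im ^ 2 = z.re ^ 2 - z.im ^ 2 + q := by
  have := congrArg Complex.re (root_sq z q)
  simp [pow_two] at this
  nlinarith

theorem re_le_re_root {z : ℂ} (hz : 0 < z.re) {q : ℝ} (hq : 0 ≤ q) :
    z.re ≤ (root z q).re := by
  have ha := re_root_pos hz hq
  have h1 := re_mul_im_root z q
  have h2 := re_sq_sub_im_sq_root z q
  by_contra! h
  have h3 : (root z q).re ^ 2 < z.re ^ 2 := by gcongr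
  have h4 : z.im ^ 2 ≤ (root z q).im ^ 2 := by
    have : (root z q).re ^ 2 * (root z q).im ^ 2 = z.re ^ 2 * z.im ^ 2 := by
      rw [← mul_pow, h1, mul_pow]
    by_contra! h5
    have : (root z q).re ^ 2 * (root z q).im ^ 2 < z.re ^ 2 * z.im ^ 2 := by gcongr
    linarith
  linarith

theorem sqrt_sub_abs_im_le_re_root {z : ℂ} (hz : 0 < z.re) {q : ℝ} (hq : 0 ≤ q) :
    Real.sqrt q - |z.im| ≤ (root z q).re := by
  have ha := re_root_pos hz hq
  have h2 := re_sq_sub_im_sq_root z q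
  rcases le_or_gt (Real.sqrt q - |z.im|) 0 with h | h
  · linarith
  · refine le_of_sq_le_sq ?_ ha.le
    have := Real.sq_sqrt hq
    have h3 := sq_abs z.im
    nlinarith [abs_nonneg z.im, sq_nonneg (root z q).im, sq_nonneg z.re]

/-- The dispersive estimate for the kernel: it comes from the identity
`Re ζ · Im ζ = Re z · Im z` for `ζ = √(z² + q)`, whatever the size of `q`. -/
theorem norm_green_le {z : ℂ} (hz : 0 < z.re) {q : ℝ} (hq : 0 ≤ q) :
    ‖green z q‖ ≤ 3 / (z.re * (1 + |z.im|)) * Real.exp (-((root z q).re / 2)) := by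
  have ha := re_root_pos hz hq
  have h0 : 0 < ‖root z q‖ := ha.trans_le (Complex.re_le_norm _)
  have h1 : z.re ≤ ‖root z q‖ := (re_le_re_root hz hq).trans (Complex.re_le_norm _)
  have h2 : z.re * |z.im| ≤ (root z q).re * ‖root z q‖ := by
    rw [← abs_of_pos hz, ← abs_mul, ← re_mul_im_root z q, abs_mul, abs_of_pos ha]
    gcongr
    exact Complex.abs_im_le_norm _
  have h3 : 1 + (root z q).re ≤ 3 * Real.exp ((root z q).re / 2) := by
    have := Real.add_one_le_exp ((root z q).re / 2)
    linarith
  have h4 : z.re * (1 + |z.im|) ≤ ‖root z q‖ * (3 * Real.exp ((root z q).re / 2)) := by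
    calc z.re * (1 + |z.im|) ≤ ‖root z q‖ * (1 + (root z q).re) := by linarith
      _ ≤ _ := by gcongr
  rw [green, norm_div, Complex.norm_exp, Complex.neg_re, div_mul_eq_mul_div,
    div_le_div_iff₀ h0 (by positivity)]
  calc Real.exp (-(root z q).re) * (z.re * (1 + |z.im|))
      ≤ Real.exp (-(root z q).re) * (‖root z q‖ * (3 * Real.exp ((root z q).re / 2))) := by
        gcongr
    _ = 3 * (Real.exp (-(root z q).re) * Real.exp ((root z q).re / 2)) * ‖root z q‖ := by ring
    _ = _ := by
        rw [← Real.exp_add]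
        congr 3
        ring

theorem differentiableAt_green {z : ℂ} (hz : 0 < z.re) {q : ℝ} (hq : 0 ≤ q) :
    DifferentiableAt ℂ (fun z => green z q) z := by
  have h1 : DifferentiableAt ℂ (fun z => root z q) z := by
    unfold root
    refine DifferentiableAt.cpow (by fun_prop) (by fun_prop) (sq_add_mem_slitPlane hz hq)
  have h2 : root z q ≠ 0 := fun h => by
    have := re_root_pos hz hq
    simp [h] at this
  exact h1.neg.cexp.div h1 h2

/-! ### Summability over the lattices -/

theorem hasSum_mul_fin_two {A : Type*} [NormedRing A] [CompleteSpace A] {f g : ℤ → A}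
    (hf : Summable fun n => ‖f n‖) (hg : Summable fun n => ‖g n‖) :
    HasSum (fun n : Fin 2 → ℤ => f (n 0) * g (n 1)) ((∑' n, f n) * ∑' n, g n) := by
  have h := (summable_mul_of_summable_norm hf hg).hasSum
  rw [← tsum_mul_tsum_of_summable_norm hf hg] at h
  have h' := (finTwoArrowEquiv ℤ).hasSum_iff.mpr h
  simpa only [Function.comp_def, finTwoArrowEquiv_apply, Equiv.toFun_as_coe,
    piFinTwoEquiv_apply] using h'

theorem summable_exp_neg_mul_abs {c : ℝ} (hc : 0 < c) :
    Summable fun n : ℤ => Real.exp (-(c * |(n : ℝ)|)) := by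
  have h : Summable fun n : ℕ => Real.exp (-(c * (n : ℝ))) := by
    refine (Real.summable_exp_nat_mul_iff.mpr (neg_lt_zero.mpr hc)).congr fun n => ?_
    congr 1
    ring
  refine Summable.of_nat_of_neg ?_ ?_ <;> simpa using h

theorem summable_exp_neg_mul_l1 {c : ℝ} (hc : 0 < c) :
    Summable fun n : Fin 2 → ℤ => Real.exp (-(c * (|(n 0 : ℝ)| + |(n 1 : ℝ)|))) := by
  have h := (summable_exp_neg_mul_abs hc).norm
  refine (hasSum_mul_fin_two h h).summable.congr fun n => ?_
  rw [← Real.exp_add]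
  congr 1
  ring

theorem summable_exp_neg_sq {a : ℝ} (ha : 0 < a) (b : ℝ) :
    Summable fun n : ℤ => Real.exp (-(a * n + b) ^ 2) := by
  refine Summable.of_nonneg_of_le (fun _ => (Real.exp_pos _).le) (fun n => ?_)
    ((summable_exp_neg_mul_abs two_pos).mul_left (Real.exp (2 * |b| / a + 1 / a ^ 2)))
  rw [← Real.exp_add, Real.exp_le_exp]
  -- Completing the square: `u ^ 2 ≥ (2 / a) * |u| - 1 / a ^ 2` for `u = a * n + b`.
  have h1 : 0 ≤ (|a * n + b| - 1 / a) ^ 2 := sq_nonneg _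
  have h2 : a * |(n : ℝ)| - |b| ≤ |a * n + b| := by
    rw [← abs_of_pos ha, ← abs_mul, abs_of_pos ha]
    simpa using abs_sub_abs_le_abs_sub (a * (n : ℝ)) (-b)
  have h3 : 2 * |(n : ℝ)| - 2 * |b| / a ≤ 2 * (|a * n + b| * (1 / a)) := by
    have := mul_le_mul_of_nonneg_right h2 (by positivity : 0 ≤ 2 / a)
    calc _ = (a * |(n : ℝ)| - |b|) * (2 / a) := by field_simp
      _ ≤ _ := this
      _ = _ := by ring
  have h4 : (1 / a) ^ 2 = 1 / a ^ 2 := by ring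
  have h5 := sq_abs (a * (n : ℝ) + b)
  nlinarith

/-- The squared distance from `x` to the point `R m` of the lattice `(Rℤ)²`. -/
def sqDist (R : ℝ) (x : Fin 2 → ℝ) (m : Fin 2 → ℤ) : ℝ := ∑ i, (R * m i - x i) ^ 2

theorem sqDist_nonneg (R : ℝ) (x : Fin 2 → ℝ) (m : Fin 2 → ℤ) : 0 ≤ sqDist R x m :=
  Finset.sum_nonneg fun _ _ => sq_nonneg _

theorem le_sqrt_sqDist {R : ℝ} (hR : 0 < R) (x : Fin 2 → ℝ) (m : Fin 2 → ℤ) :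
    R / 2 * (|(m 0 : ℝ)| + |(m 1 : ℝ)|) - (|x 0| + |x 1|) / 2 ≤ Real.sqrt (sqDist R x m) := by
  have h : ∀ i, R * |(m i : ℝ)| - |x i| ≤ Real.sqrt (sqDist R x m) := by
    intro i
    have h1 : |R * m i - x i| ≤ Real.sqrt (sqDist R x m) := by
      rw [← Real.sqrt_sq_eq_abs]
      exact Real.sqrt_le_sqrt (Finset.single_le_sum (f := fun i => (R * m i - x i) ^ 2)
        (fun _ _ => sq_nonneg _) (Finset.mem_univ i))
    have h2 := abs_sub_abs_le_abs_sub (R * (m i : ℝ)) (x i)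
    rw [abs_mul, abs_of_pos hR] at h2
    linarith
  linarith [h 0, h 1]

theorem summable_exp_neg_mul_sqrt_sqDist {R c : ℝ} (hR : 0 < R) (hc : 0 < c) (x : Fin 2 → ℝ) :
    Summable fun m => Real.exp (-(c * Real.sqrt (sqDist R x m))) := by
  refine Summable.of_nonneg_of_le (fun _ => (Real.exp_pos _).le) (fun m => ?_)
    ((summable_exp_neg_mul_l1 (by positivity : 0 < c * (R / 2))).mul_left
      (Real.exp (c * ((|x 0| + |x 1|) / 2))))
  rw [← Real.exp_add, Real.exp_le_exp]
  nlinarith [mul_le_mul_of_nonneg_left (le_sqrt_sqDist hR x m) hc.le]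

theorem norm_freq_sq (R : ℝ) (n : Fin 2 → ℤ) :
    ‖freq R n‖ ^ 2 = (2 * Real.pi * n 0 / R) ^ 2 + (2 * Real.pi * n 1 / R) ^ 2 := by
  rw [EuclideanSpace.real_norm_sq_eq, Fin.sum_univ_two]
  rfl

theorem one_le_bracket (ξ : Freq) : 1 ≤ bracket ξ :=
  Real.one_le_sqrt.mpr (by nlinarith [sq_nonneg ‖ξ‖])

theorem bracket_pos (ξ : Freq) : 0 < bracket ξ := one_pos.trans_le (one_le_bracket ξ)

theorem bracket_sq (ξ : Freq) : bracket ξ ^ 2 = 1 + ‖ξ‖ ^ 2 := Real.sq_sqrt (by positivity)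

theorem le_bracket_freq {R : ℝ} (hR : 0 < R) (n : Fin 2 → ℤ) :
    Real.pi / R * (|(n 0 : ℝ)| + |(n 1 : ℝ)|) ≤ bracket (freq R n) := by
  refine le_of_sq_le_sq ?_ (bracket_pos _).le
  rw [bracket_sq, norm_freq_sq]
  have h : (2 * Real.pi * n 0 / R) ^ 2 + (2 * Real.pi * n 1 / R) ^ 2 =
      (Real.pi / R) ^ 2 * (4 * |(n 0 : ℝ)| ^ 2 + 4 * |(n 1 : ℝ)| ^ 2) := by
    rw [sq_abs, sq_abs]
    ring
  rw [h, mul_pow]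
  have : (Real.pi / R) ^ 2 * (|(n 0 : ℝ)| + |(n 1 : ℝ)|) ^ 2 ≤
      (Real.pi / R) ^ 2 * (4 * |(n 0 : ℝ)| ^ 2 + 4 * |(n 1 : ℝ)| ^ 2) := by
    gcongr
    nlinarith [sq_nonneg (|(n 0 : ℝ)| - |(n 1 : ℝ)|), sq_nonneg (n 0 : ℝ), sq_nonneg (n 1 : ℝ),
      sq_abs (n 0 : ℝ), sq_abs (n 1 : ℝ)]
  linarith

theorem summable_exp_neg_mul_bracket {R c : ℝ} (hR : 0 < R) (hc : 0 < c) :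
    Summable fun n => Real.exp (-(c * bracket (freq R n))) := by
  refine Summable.of_nonneg_of_le (fun _ => (Real.exp_pos _).le) (fun n => ?_)
    (summable_exp_neg_mul_l1 (by positivity : 0 < c * (Real.pi / R)))
  rw [Real.exp_le_exp, mul_assoc]
  exact neg_le_neg (mul_le_mul_of_nonneg_left (le_bracket_freq hR n) hc.le)

/-! ### The periodized kernel -/

/-- The character `exp (i x · ξ)`, `ξ = 2πn/R`, as a function on the plane. -/
noncomputable def planeWave (R : ℝ) (n : Fin 2 → ℤ) (x : Fin 2 → ℝ) : ℂ :=
  ∏ i, Complex.exp (2 * Real.pi * Complex.I * n i * x i / R)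

theorem character_coe (R : ℝ) (n : Fin 2 → ℤ) (x : Fin 2 → ℝ) :
    character R n (fun i => (x i : AddCircle R)) = planeWave R n x := by
  simp only [character, ContinuousMap.coe_mk, planeWave, fourier_coe_apply]

theorem norm_planeWave (R : ℝ) (n : Fin 2 → ℤ) (x : Fin 2 → ℝ) : ‖planeWave R n x‖ = 1 := by
  rw [planeWave, norm_prod]
  refine Finset.prod_eq_one fun i _ => ?_
  rw [show 2 * Real.pi * Complex.I * n i * x i / R =
    ((2 * Real.pi * n i * x i / R : ℝ) : ℂ) * Complex.I by push_cast; ring]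
  exact Complex.norm_exp_ofReal_mul_I _

theorem tsum_gaussian {R y : ℝ} (hR : 0 < R) (hy : 0 < y) (x : ℝ) :
    ∑' n : ℤ, Complex.exp (2 * Real.pi * Complex.I * n * x / R) *
        (Real.exp (-(2 * Real.pi * y / R * n + 0) ^ 2) : ℂ) =
      (R / (2 * Real.sqrt Real.pi * y) : ℝ) *
        ∑' m : ℤ, (Real.exp (-(R / (2 * y) * m + -x / (2 * y)) ^ 2) : ℂ) := by
  have hpi := Real.pi_pos
  have hpc : (Real.pi : ℂ) ≠ 0 := by exact_mod_cast hpi.ne'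
  have hRc : (R : ℂ) ≠ 0 := by exact_mod_cast hR.ne'
  have hyc : (y : ℂ) ≠ 0 := by exact_mod_cast hy.ne'
  have ha : 0 < 4 * Real.pi * y ^ 2 / R ^ 2 := by positivity
  have h := Complex.tsum_exp_neg_quadratic (a := ((4 * Real.pi * y ^ 2 / R ^ 2 : ℝ) : ℂ))
    (by rwa [Complex.ofReal_re]) (Complex.I * x / R)
  have e : (1 : ℂ) / ((4 * Real.pi * y ^ 2 / R ^ 2 : ℝ) : ℂ) ^ (1 / 2 : ℂ) =
      (R / (2 * Real.sqrt Real.pi * y) : ℝ) := by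
    rw [show (1 / 2 : ℂ) = ((1 / 2 : ℝ) : ℂ) by push_cast; rfl, ← Complex.ofReal_cpow ha.le,
      ← Real.sqrt_eq_rpow]
    have : Real.sqrt (4 * Real.pi * y ^ 2 / R ^ 2) = 2 * Real.sqrt Real.pi * y / R := by
      rw [← Real.sqrt_sq (by positivity : 0 ≤ 2 * Real.sqrt Real.pi * y / R), div_pow, mul_pow,
        mul_pow, Real.sq_sqrt hpi.le]
      ring_nf
    rw [this]
    push_cast
    rw [one_div, inv_div]
  rw [e] at h
  refine Eq.trans (tsum_congr fun n => ?_) (h.trans ?_)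
  · rw [Complex.ofReal_exp, ← Complex.exp_add]
    congr 1
    push_cast
    field_simp
    ring
  · congr 1
    refine tsum_congr fun m => ?_
    rw [Complex.ofReal_exp]
    congr 1
    push_cast
    field_simp
    ring_nf
    simp only [Complex.I_sq]
    ring_nf
    simp only [Complex.I_pow_four]
    ring

/-- Poisson summation for the Gaussian on the square torus. -/
theorem tsum_planeWave_mul_gaussian {R y : ℝ} (hR : 0 < R) (hy : 0 < y) (x : Fin 2 → ℝ) :
    ∑' n, planeWave R n x * (Real.exp (-(y ^ 2 * ‖freq R n‖ ^ 2)) : ℂ) =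
      (R ^ 2 / (4 * Real.pi * y ^ 2) : ℝ) *
        ∑' m, (Real.exp (-(sqDist R x m / (4 * y ^ 2))) : ℂ) := by
  have hpi := Real.pi_pos
  have s1 : ∀ x : ℝ, Summable fun n : ℤ => ‖Complex.exp (2 * Real.pi * Complex.I * n * x / R) *
      (Real.exp (-(2 * Real.pi * y / R * n + 0) ^ 2) : ℂ)‖ := by
    intro x
    refine (summable_exp_neg_sq (a := 2 * Real.pi * y / R) (by positivity) 0).congr fun n => ?_
    rw [norm_mul, show 2 * Real.pi * Complex.I * n * x / R =
      ((2 * Real.pi * n * x / R : ℝ) : ℂ) * Complex.I by push_cast; ring,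
      Complex.norm_exp_ofReal_mul_I, one_mul, Complex.norm_real,
      Real.norm_of_nonneg (Real.exp_pos _).le]
  have s2 : ∀ x : ℝ, Summable fun m : ℤ =>
      ‖(Real.exp (-(R / (2 * y) * m + -x / (2 * y)) ^ 2) : ℂ)‖ := by
    intro x
    refine (summable_exp_neg_sq (a := R / (2 * y)) (by positivity) (-x / (2 * y))).congr
      fun n => ?_
    rw [Complex.norm_real, Real.norm_of_nonneg (Real.exp_pos _).le]
  have h1 := (hasSum_mul_fin_two (s1 (x 0)) (s1 (x 1))).tsum_eq
  have h2 := (hasSum_mul_fin_two (s2 (x 0)) (s2 (x 1))).tsum_eq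
  rw [tsum_gaussian hR hy, tsum_gaussian hR hy, mul_mul_mul_comm, ← h2] at h1
  refine Eq.trans (tsum_congr fun n => ?_) (h1.trans ?_)
  · rw [planeWave, Fin.prod_univ_two, mul_mul_mul_comm, ← Complex.ofReal_mul, ← Real.exp_add,
      norm_freq_sq]
    congr 3
    ring
  · rw [← Complex.ofReal_mul]
    congr 1
    · congr 1
      field_simp
      rw [Real.sq_sqrt hpi.le]
      ring
    · refine tsum_congr fun m => ?_
      rw [← Complex.ofReal_mul, ← Real.exp_add, sqDist, Fin.sum_univ_two]
      congr 2
      field_simp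
      ring

theorem tsum_planeWave_mul_exp_ofReal {R z : ℝ} (hR : 0 < R) (hz : 0 < z) (x : Fin 2 → ℝ) :
    ∑' n, planeWave R n x *
        (Complex.exp (-(z * bracket (freq R n))) / bracket (freq R n)) =
      (R ^ 2 / (2 * Real.pi) : ℝ) * ∑' m, green z (sqDist R x m) := by
  have hpi := Real.pi_pos
  have hsp : 0 < Real.sqrt Real.pi := Real.sqrt_pos.mpr hpi
  have hz2 : 0 < z / 2 := by positivity
  set r : (Fin 2 → ℤ) → ℝ := fun m => Real.sqrt (z ^ 2 + sqDist R x m) with hr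
  have hq := sqDist_nonneg R x
  have hrpos : ∀ m, 0 < r m / 2 := fun m =>
    half_pos (Real.sqrt_pos.mpr (by have := hq m; positivity))
  have hrz : ∀ m, z ≤ r m := fun m => Real.le_sqrt_of_sq_le (by linarith [hq m])
  have hrq : ∀ m, Real.sqrt (sqDist R x m) ≤ r m := fun m =>
    Real.sqrt_le_sqrt (by nlinarith [hq m])
  -- Both sides are written as superpositions of Gaussians.
  let F : (Fin 2 → ℤ) → ℝ → ℂ := fun n y => planeWave R n x *
    (Real.exp (-((bracket (freq R n) * y) ^ 2 + (z / 2 / y) ^ 2)) : ℂ)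
  let G : (Fin 2 → ℤ) → ℝ → ℂ := fun m y =>
    (((y ^ 2)⁻¹ * Real.exp (-((1 * y) ^ 2 + (r m / 2 / y) ^ 2)) : ℝ) : ℂ)
  have iF : ∀ n, ∫ y in Set.Ioi (0 : ℝ), F n y = (Real.sqrt Real.pi / 2 : ℝ) *
      (planeWave R n x * (Complex.exp (-(z * bracket (freq R n))) / bracket (freq R n))) := by
    intro n
    have hb : (bracket (freq R n) : ℂ) ≠ 0 := by exact_mod_cast (bracket_pos _).ne'
    simp only [F]
    rw [integral_const_mul, integral_complex_ofReal,
      (integral_exp_neg_sq_add_inv_sq (bracket_pos (freq R n)) hz2).1]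
    push_cast
    field_simp
  have nF : ∀ n, ∫ y in Set.Ioi (0 : ℝ), ‖F n y‖ =
      Real.sqrt Real.pi / (2 * bracket (freq R n)) *
        Real.exp (-(2 * bracket (freq R n) * (z / 2))) := by
    intro n
    rw [← (integral_exp_neg_sq_add_inv_sq (bracket_pos (freq R n)) hz2).1]
    congr 1 with y
    rw [norm_mul, norm_planeWave, one_mul, Complex.norm_real,
      Real.norm_of_nonneg (Real.exp_pos _).le]
  have iG : ∀ m, ∫ y in Set.Ioi (0 : ℝ), G m y =
      (Real.sqrt Real.pi : ℂ) * green z (sqDist R x m) := by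
    intro m
    have hb : (r m : ℂ) ≠ 0 := by exact_mod_cast (by linarith [hrpos m] : r m ≠ 0)
    simp only [G]
    rw [integral_complex_ofReal, (integral_exp_neg_sq_add_inv_sq one_pos (hrpos m)).2, green,
      root_ofReal _ (by have := hq m; positivity)]
    change _ = _ * (Complex.exp (-(r m : ℂ)) / (r m : ℂ))
    push_cast
    field_simp
  have nG : ∀ m, ∫ y in Set.Ioi (0 : ℝ), ‖G m y‖ =
      Real.sqrt Real.pi / (2 * (r m / 2)) * Real.exp (-(2 * 1 * (r m / 2))) := by
    intro m
    rw [← (integral_exp_neg_sq_add_inv_sq one_pos (hrpos m)).2]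
    congr 1 with y
    rw [Complex.norm_real, Real.norm_of_nonneg (by positivity)]
  have sF := integral_tsum_of_summable_integral_norm (μ := volume.restrict (Set.Ioi (0 : ℝ)))
    (F := F) (fun n => by
      exact ((integrableOn_exp_neg_sq_add_inv_sq (bracket_pos (freq R n)) hz2).ofReal).const_mul
        (planeWave R n x)) (by
      simp only [nF]
      refine Summable.of_nonneg_of_le (fun n => ?_) (fun n => ?_)
        ((summable_exp_neg_mul_bracket hR hz).mul_left (Real.sqrt Real.pi))
      · have := bracket_pos (freq R n)
        positivity
      · have := one_le_bracket (freq R n)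
        rw [show 2 * bracket (freq R n) * (z / 2) = z * bracket (freq R n) by ring]
        gcongr
        exact div_le_self hsp.le (by linarith))
  have sG := integral_tsum_of_summable_integral_norm (μ := volume.restrict (Set.Ioi (0 : ℝ)))
    (F := G) (fun m => by
      exact (integrableOn_inv_sq_mul_exp_neg_sq_add_inv_sq one_pos (hrpos m)).ofReal) (by
      simp only [nG]
      refine Summable.of_nonneg_of_le (fun m => ?_) (fun m => ?_)
        ((summable_exp_neg_mul_sqrt_sqDist hR one_pos x).mul_left (Real.sqrt Real.pi / z))
      · have := hrpos m
        positivity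
      · rw [show 2 * 1 * (r m / 2) = r m by ring, show 2 * (r m / 2) = r m by ring, one_mul]
        have h1 := hrz m
        have h2 := hrq m
        gcongr)
  have hpt : ∀ y ∈ Set.Ioi (0 : ℝ), ∑' n, F n y =
      (R ^ 2 / (4 * Real.pi) : ℝ) * ∑' m, G m y := by
    intro y hy
    have hy0 : (0 : ℝ) < y := hy
    have h1 : ∀ n, F n y = (Real.exp (-(y ^ 2 + (z / 2 / y) ^ 2)) : ℂ) *
        (planeWave R n x * (Real.exp (-(y ^ 2 * ‖freq R n‖ ^ 2)) : ℂ)) := by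
      intro n
      simp only [F]
      rw [mul_left_comm, ← Complex.ofReal_mul, ← Real.exp_add, mul_pow, bracket_sq]
      congr 3
      ring
    have h2 : ∀ m, G m y = ((y ^ 2)⁻¹ * Real.exp (-(y ^ 2 + (z / 2 / y) ^ 2)) : ℝ) *
        (Real.exp (-(sqDist R x m / (4 * y ^ 2))) : ℂ) := by
      intro m
      simp only [G]
      rw [← Complex.ofReal_mul, mul_assoc, ← Real.exp_add, div_pow, div_pow, hr,
        Real.sq_sqrt (by have := hq m; positivity)]
      congr 3
      ring
    simp only [h1, h2]
    rw [tsum_mul_left, tsum_mul_left, tsum_planeWave_mul_gaussian hR hy0, ← mul_assoc,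
      ← mul_assoc, ← Complex.ofReal_mul, ← Complex.ofReal_mul]
    congr 2
    field_simp
  rw [setIntegral_congr_fun measurableSet_Ioi hpt, integral_const_mul, ← sG] at sF
  simp only [iF, iG] at sF
  rw [tsum_mul_left, tsum_mul_left] at sF
  have hc : ((Real.sqrt Real.pi / 2 : ℝ) : ℂ) ≠ 0 := by
    exact_mod_cast (by positivity : Real.sqrt Real.pi / 2 ≠ 0)
  refine mul_left_cancel₀ hc (sF.trans ?_)
  rw [← mul_assoc, ← mul_assoc, ← Complex.ofReal_mul, ← Complex.ofReal_mul]
  congr 2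
  field_simp
  ring

/-- The Poisson summation formula for `exp (-zΛ) / Λ`, by analytic continuation from `z > 0`. -/
theorem tsum_planeWave_mul_exp {R : ℝ} {z : ℂ} (hR : 0 < R) (hz : 0 < z.re) (x : Fin 2 → ℝ) :
    ∑' n, planeWave R n x *
        (Complex.exp (-(z * bracket (freq R n))) / bracket (freq R n)) =
      (R ^ 2 / (2 * Real.pi) : ℝ) * ∑' m, green z (sqDist R x m) := by
  set U : Set ℂ := Set.Ioi (z.re / 2) ×ℂ Set.Ioo (-(|z.im| + 1)) (|z.im| + 1) with hU
  have hUo : IsOpen U := isOpen_Ioi.reProdIm isOpen_Ioo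
  have hUc : IsPreconnected U := (((convex_Ioi _).linear_preimage Complex.reLm).inter
    ((convex_Ioo _ _).linear_preimage Complex.imLm)).isPreconnected
  have hUre : ∀ w ∈ U, z.re / 2 < w.re := fun w hw => (Complex.mem_reProdIm.mp hw).1
  have hUim : ∀ w ∈ U, |w.im| ≤ |z.im| + 1 := fun w hw =>
    (abs_lt.mpr (Complex.mem_reProdIm.mp hw).2).le
  have hUpos : ∀ w ∈ U, 0 < w.re := fun w hw => (half_pos hz).trans (hUre w hw)
  have hzU : z ∈ U := by
    refine Complex.mem_reProdIm.mpr ⟨half_lt_self hz, abs_lt.mp (lt_add_one _)⟩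
  have h0U : (z.re : ℂ) ∈ U := by
    refine Complex.mem_reProdIm.mpr ⟨?_, abs_lt.mp ?_⟩
    · rw [Complex.ofReal_re]
      exact half_lt_self hz
    · rw [Complex.ofReal_im, abs_zero]
      positivity
  have hf : DifferentiableOn ℂ (fun w : ℂ => ∑' n, planeWave R n x *
      (Complex.exp (-(w * bracket (freq R n))) / bracket (freq R n))) U := by
    refine Complex.differentiableOn_tsum_of_summable_norm
      (summable_exp_neg_mul_bracket hR (half_pos hz)) (fun n => ?_) hUo (fun n w hw => ?_)
    · fun_prop
    · have h1 := one_le_bracket (freq R n)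
      have h2 := hUre w hw
      rw [norm_mul, norm_planeWave, one_mul, norm_div, Complex.norm_exp, Complex.neg_re,
        Complex.re_mul_ofReal, Complex.norm_real, Real.norm_of_nonneg (bracket_pos _).le]
      refine (div_le_self (Real.exp_pos _).le h1).trans ?_
      gcongr
  have hg : DifferentiableOn ℂ (fun w : ℂ => ((R ^ 2 / (2 * Real.pi) : ℝ) : ℂ) *
      ∑' m, green w (sqDist R x m)) U := by
    refine DifferentiableOn.const_mul ?_ _
    refine Complex.differentiableOn_tsum_of_summable_norm
      ((summable_exp_neg_mul_sqrt_sqDist hR (half_pos one_pos) x).mul_left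
        (3 / (z.re / 2) * Real.exp ((|z.im| + 1) / 2))) (fun m => ?_) hUo (fun m w hw => ?_)
    · exact fun w hw =>
        (differentiableAt_green (hUpos w hw) (sqDist_nonneg R x m)).differentiableWithinAt
    · refine (norm_green_le (hUpos w hw) (sqDist_nonneg R x m)).trans ?_
      have h1 := (hUre w hw).le
      have h2 := hUim w hw
      have h3 := sqrt_sub_abs_im_le_re_root (hUpos w hw) (sqDist_nonneg R x m)
      rw [mul_assoc, ← Real.exp_add]
      gcongr
      · calc z.re / 2 ≤ w.re * 1 := by linarith
          _ ≤ w.re * (1 + |w.im|) := by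
            have := hUpos w hw
            gcongr
            linarith [abs_nonneg w.im]
      · linarith
  refine (hf.analyticOnNhd hUo).eqOn_of_preconnected_of_frequently_eq (hg.analyticOnNhd hUo) hUc
    h0U ?_ hzU
  have ht : Filter.Tendsto (fun t : ℝ => (t : ℂ)) (nhdsWithin z.re {z.re}ᶜ)
      (nhdsWithin (z.re : ℂ) {(z.re : ℂ)}ᶜ) := by
    refine Complex.continuous_ofReal.continuousAt.continuousWithinAt.tendsto_nhdsWithin ?_
    intro t ht
    simpa using ht
  refine ht.frequently (Filter.Eventually.frequently ?_)
  filter_upwards [nhdsWithin_le_nhds (lt_mem_nhds hz)] with t ht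
  exact tsum_planeWave_mul_exp_ofReal hR ht x

/-- The dispersive estimate on the torus: up to time `R` only boundedly many images of the
origin are felt. -/
theorem exists_norm_tsum_planeWave_le : ∃ C : ℝ, 0 < C ∧ ∀ R : ℝ, 2 ≤ R → ∀ x : Fin 2 → ℝ,
    (∀ i, |x i| ≤ R / 2) → ∀ z : ℂ, 0 < z.re → |z.im| ≤ R →
      ‖∑' n, planeWave R n x *
        (Complex.exp (-(z * bracket (freq R n))) / bracket (freq R n))‖ ≤
        C * R ^ 2 / (z.re * (1 + |z.im|)) := by
  have hs := summable_exp_neg_mul_l1 (half_pos one_pos)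
  set S : ℝ := ∑' n : Fin 2 → ℤ, Real.exp (-(1 / 2 * (|(n 0 : ℝ)| + |(n 1 : ℝ)|))) with hS
  have hSpos : 0 < S := hs.tsum_pos (fun _ => (Real.exp_pos _).le) 0 (Real.exp_pos _)
  have hpi := Real.pi_pos
  refine ⟨1 / (2 * Real.pi) * (3 * Real.exp (3 / 2)) * S, by positivity, ?_⟩
  intro R hR x hx z hz him
  have hR0 : 0 < R := by linarith
  rw [tsum_planeWave_mul_exp hR0 hz, norm_mul, Complex.norm_real,
    Real.norm_of_nonneg (by positivity)]
  have hb : ‖∑' m, green z (sqDist R x m)‖ ≤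
      3 / (z.re * (1 + |z.im|)) * Real.exp (3 / 2) * S := by
    refine tsum_of_norm_bounded (hs.hasSum.mul_left _) fun m => ?_
    refine (norm_green_le hz (sqDist_nonneg R x m)).trans ?_
    rw [mul_assoc, ← Real.exp_add]
    gcongr
    have h1 := re_root_pos hz (sqDist_nonneg R x m)
    have h2 := sqrt_sub_abs_im_le_re_root hz (sqDist_nonneg R x m)
    have h3 := le_sqrt_sqDist hR0 x m
    set l := |(m 0 : ℝ)| + |(m 1 : ℝ)|
    -- The images with `l ≤ 3` are bounded by the decay in time, the others by their distance.
    rcases le_or_gt l 3 with hl | hl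
    · linarith
    · have h4 : R / 2 * (l - 3) ≤ (root z (sqDist R x m)).re := by linarith [hx 0, hx 1]
      have h5 : 1 * (l - 3) ≤ R / 2 * (l - 3) := by
        gcongr
        linarith
      linarith
  calc R ^ 2 / (2 * Real.pi) * ‖∑' m, green z (sqDist R x m)‖
      ≤ R ^ 2 / (2 * Real.pi) * (3 / (z.re * (1 + |z.im|)) * Real.exp (3 / 2) * S) := by gcongr
    _ = _ := by ring

/-! ### The `TT*` argument -/

/-- The `TT*` argument for `T c = ∑ n, c n • v n` with weights `w`: the kernel of `T T*` is
`∑ n, w n * v n s * conj (v n s')`, and Schur's test applies to its majorant `κ`. -/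
theorem integral_norm_sum_sq_le {α ι : Type*} [MeasurableSpace α] [Countable ι] {μ : Measure α}
    [IsFiniteMeasure μ] {T : Set α} (hT : ∀ᵐ s ∂μ, s ∈ T)
    {v : ι → α → ℂ} (hv : ∀ n, Measurable (v n)) (hv1 : ∀ n s, ‖v n s‖ ≤ 1)
    {w : ι → ℝ} (hw : ∀ n, 0 < w n) (hws : Summable w)
    {κ : α → α → ℝ} {A B : ℝ} (hκm : Measurable fun p : α × α => κ p.1 p.2)
    (hκ0 : ∀ s s', 0 ≤ κ s s') (hκB : ∀ s s', κ s s' ≤ B) (hκs : ∀ s s', κ s s' = κ s' s)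
    (hA0 : 0 ≤ A) (hA : ∀ s ∈ T, ∫ s', κ s s' ∂μ ≤ A)
    (hker : ∀ s ∈ T, ∀ s' ∈ T, ‖∑' n, (w n : ℂ) * (v n s * conj (v n s'))‖ ≤ κ s s')
    (S : Finset ι) (c : ι → ℂ) :
    ∫ s, ‖∑ n ∈ S, c n * v n s‖ ^ 2 ∂μ ≤ A * ∑ n ∈ S, ‖c n‖ ^ 2 / w n := by
  set g : α → ℂ := fun s => ∑ n ∈ S, c n * v n s with hg
  set G : ℝ := ∑ n ∈ S, ‖c n‖ with hG
  have hG0 : 0 ≤ G := Finset.sum_nonneg fun _ _ => norm_nonneg _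
  have hgm : Measurable g := by fun_prop
  have hgG : ∀ s, ‖g s‖ ≤ G := fun s => (norm_sum_le _ _).trans (Finset.sum_le_sum fun n _ => by
    rw [norm_mul]
    exact mul_le_of_le_one_right (norm_nonneg _) (hv1 n s))
  have hG2 : ∀ s, ‖g s‖ ^ 2 ≤ G ^ 2 := fun s => pow_le_pow_left₀ (norm_nonneg _) (hgG s) 2
  set N : ℝ := ∫ s, ‖g s‖ ^ 2 ∂μ with hN
  have hN0 : 0 ≤ N := integral_nonneg fun _ => by positivity
  let b : ι → ℂ := fun n => ∫ s, v n s * conj (g s) ∂μ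
  have hvg : ∀ n s, ‖v n s * conj (g s)‖ ≤ G := fun n s => by
    rw [norm_mul, RCLike.norm_conj]
    exact (mul_le_of_le_one_left (norm_nonneg _) (hv1 n s)).trans (hgG s)
  have hvgm : ∀ n, Measurable fun s => v n s * conj (g s) := fun n =>
    (hv n).mul (Complex.continuous_conj.measurable.comp hgm)
  have hvgi : ∀ n, Integrable (fun s => v n s * conj (g s)) μ := fun n =>
    Integrable.of_bound (hvgm n).aestronglyMeasurable G (Filter.Eventually.of_forall (hvg n))
  have hNb : (N : ℂ) = ∑ n ∈ S, c n * b n := by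
    simp only [b, ← integral_const_mul]
    rw [← integral_finsetSum _ fun n _ => (hvgi n).const_mul (c n), hN,
      ← integral_complex_ofReal]
    congr 1 with s
    rw [Complex.ofReal_pow, ← Complex.mul_conj', hg, Finset.sum_mul]
    exact Finset.sum_congr rfl fun n _ => by ring
  have hNle : N ≤ ∑ n ∈ S, ‖c n‖ * ‖b n‖ := by
    calc N = ‖(N : ℂ)‖ := by rw [Complex.norm_real, Real.norm_of_nonneg hN0]
      _ ≤ ∑ n ∈ S, ‖c n * b n‖ := by
        rw [hNb]
        exact norm_sum_le _ _
      _ = _ := by simp only [norm_mul]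
  have hCS : (∑ n ∈ S, ‖c n‖ * ‖b n‖) ^ 2 ≤
      (∑ n ∈ S, ‖c n‖ ^ 2 / w n) * ∑ n ∈ S, w n * ‖b n‖ ^ 2 := by
    refine Finset.sum_sq_le_sum_mul_sum_of_sq_le_mul _ (fun n _ => ?_) (fun n _ => ?_)
      (fun n _ => ?_)
    · have := hw n
      positivity
    · have := hw n
      positivity
    · have := (hw n).ne'
      refine le_of_eq ?_
      field_simp
  -- The quadratic form of the kernel.
  let F : ι → α × α → ℂ := fun n p =>
    (w n : ℂ) * ((v n p.1 * conj (g p.1)) * conj (v n p.2 * conj (g p.2)))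
  have hFb : ∀ n p, ‖F n p‖ ≤ w n * G ^ 2 := fun n p => by
    rw [norm_mul, norm_mul, RCLike.norm_conj, Complex.norm_real, Real.norm_of_nonneg (hw n).le,
      pow_two]
    have := (hw n).le
    gcongr
    · exact hvg n _
    · exact hvg n _
  have hFm : ∀ n, Measurable (F n) := fun n =>
    (((hvgm n).comp measurable_fst).mul (Complex.continuous_conj.measurable.comp
      ((hvgm n).comp measurable_snd))).const_mul _
  have hFi : ∀ n, Integrable (F n) (μ.prod μ) := fun n =>
    Integrable.of_bound (hFm n).aestronglyMeasurable _ (Filter.Eventually.of_forall (hFb n))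
  have hFv : ∀ n, ∫ p, F n p ∂(μ.prod μ) = ((w n * ‖b n‖ ^ 2 : ℝ) : ℂ) := fun n => by
    simp only [F]
    rw [integral_const_mul, integral_prod_mul (fun s => v n s * conj (g s))
      (fun s => conj (v n s * conj (g s))), integral_conj, Complex.mul_conj']
    push_cast
    rfl
  have hsum := hasSum_integral_of_summable_integral_norm hFi (by
    refine Summable.of_nonneg_of_le (fun n => integral_nonneg fun _ => norm_nonneg _)
      (fun n => ?_) (hws.mul_right (G ^ 2 * (μ.prod μ).real Set.univ))
    refine (integral_mono (hFi n).norm (integrable_const _) (hFb n)).trans ?_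
    rw [integral_const, smul_eq_mul]
    exact le_of_eq (by ring))
  simp only [hFv] at hsum
  have hle1 : ∑ n ∈ S, w n * ‖b n‖ ^ 2 ≤ ‖∫ p, ∑' n, F n p ∂(μ.prod μ)‖ := by
    refine le_trans ?_ (Complex.re_le_norm _)
    have h := hsum.mapL Complex.reCLM
    simp only [Complex.reCLM_apply, Complex.ofReal_re] at h
    exact sum_le_hasSum S (fun n _ => by have := hw n; positivity) h
  have hTp : ∀ᵐ p ∂(μ.prod μ), p.1 ∈ T ∧ p.2 ∈ T :=
    (Measure.quasiMeasurePreserving_fst.ae hT).and (Measure.quasiMeasurePreserving_snd.ae hT)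
  have hptw : ∀ᵐ p ∂(μ.prod μ), ‖∑' n, F n p‖ ≤
      (‖g p.1‖ ^ 2 * κ p.1 p.2 + ‖g p.2‖ ^ 2 * κ p.1 p.2) / 2 := by
    filter_upwards [hTp] with p hp
    have h1 : ∑' n, F n p =
        (∑' n, (w n : ℂ) * (v n p.1 * conj (v n p.2))) * (conj (g p.1) * g p.2) := by
      rw [← tsum_mul_right]
      refine tsum_congr fun n => ?_
      simp only [F, map_mul, Complex.conj_conj]
      ring
    rw [h1, norm_mul, norm_mul, RCLike.norm_conj]
    have h2 := hker p.1 hp.1 p.2 hp.2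
    calc _ ≤ κ p.1 p.2 * (‖g p.1‖ * ‖g p.2‖) := by gcongr
      _ ≤ κ p.1 p.2 * ((‖g p.1‖ ^ 2 + ‖g p.2‖ ^ 2) / 2) := by
        have := hκ0 p.1 p.2
        gcongr
        nlinarith [sq_nonneg (‖g p.1‖ - ‖g p.2‖)]
      _ = _ := by ring
  have hi1 : Integrable (fun p : α × α => ‖g p.1‖ ^ 2 * κ p.1 p.2) (μ.prod μ) := by
    refine Integrable.of_bound (by fun_prop) (G ^ 2 * B) (Filter.Eventually.of_forall fun p => ?_)
    rw [Real.norm_of_nonneg (mul_nonneg (by positivity) (hκ0 _ _))]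
    exact mul_le_mul (hG2 _) (hκB _ _) (hκ0 _ _) (by positivity)
  have hi2 : Integrable (fun p : α × α => ‖g p.2‖ ^ 2 * κ p.1 p.2) (μ.prod μ) := by
    refine Integrable.of_bound (by fun_prop) (G ^ 2 * B) (Filter.Eventually.of_forall fun p => ?_)
    rw [Real.norm_of_nonneg (mul_nonneg (by positivity) (hκ0 _ _))]
    exact mul_le_mul (hG2 _) (hκB _ _) (hκ0 _ _) (by positivity)
  have hv1' : ∫ p : α × α, ‖g p.1‖ ^ 2 * κ p.1 p.2 ∂(μ.prod μ) ≤ A * N := by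
    rw [integral_prod _ hi1, hN, ← integral_const_mul]
    refine integral_mono_ae hi1.integral_prod_left ?_ ?_
    · exact (Integrable.of_bound (by fun_prop) (G ^ 2) (Filter.Eventually.of_forall fun s => by
        rw [Real.norm_of_nonneg (by positivity)]
        exact hG2 s)).const_mul A
    · filter_upwards [hT] with s hs
      rw [integral_const_mul, mul_comm]
      exact mul_le_mul_of_nonneg_right (hA s hs) (by positivity)
  have hv2' : ∫ p : α × α, ‖g p.2‖ ^ 2 * κ p.1 p.2 ∂(μ.prod μ) =
      ∫ p : α × α, ‖g p.1‖ ^ 2 * κ p.1 p.2 ∂(μ.prod μ) := by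
    rw [← integral_prod_swap]
    congr 1 with p
    simp only [Prod.fst_swap, Prod.snd_swap]
    rw [hκs]
  have hle2 : ‖∫ p, ∑' n, F n p ∂(μ.prod μ)‖ ≤ A * N := by
    refine (norm_integral_le_of_norm_le ((hi1.add hi2).div_const 2) hptw).trans ?_
    simp only [Pi.add_apply]
    rw [integral_div, integral_add hi1 hi2, hv2']
    linarith
  set D := ∑ n ∈ S, ‖c n‖ ^ 2 / w n with hD
  have hD0 : 0 ≤ D := Finset.sum_nonneg fun n _ => by have := hw n; positivity
  have hfin : N * N ≤ A * D * N := by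
    calc N * N ≤ (∑ n ∈ S, ‖c n‖ * ‖b n‖) ^ 2 := by
          rw [pow_two]
          exact mul_self_le_mul_self hN0 hNle
      _ ≤ D * ∑ n ∈ S, w n * ‖b n‖ ^ 2 := hCS
      _ ≤ D * (A * N) := by
        gcongr
        exact hle1.trans hle2
      _ = _ := by ring
  rcases hN0.eq_or_lt with h | h
  · rw [← h]
    positivity
  · exact le_of_mul_le_mul_right hfin h

theorem integral_inv_one_add_abs_sub_le {a R s : ℝ} (hR : 2 ≤ R) (hs : s ∈ Set.Icc a (a + R)) :
    ∫ s' in Set.Icc a (a + R), (1 + |s - s'|)⁻¹ ≤ 4 * Real.log R := by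
  have hc : Continuous fun s' : ℝ => (1 + |s - s'|)⁻¹ :=
    Continuous.inv₀ (by fun_prop) fun s' => by positivity
  rw [integral_Icc_eq_integral_Ioc, ← intervalIntegral.integral_of_le (by linarith),
    ← intervalIntegral.integral_add_adjacent_intervals (b := s) (hc.intervalIntegrable _ _)
      (hc.intervalIntegrable _ _)]
  have h1 : ∫ s' in a..s, (1 + |s - s'|)⁻¹ = Real.log (1 + (s - a)) := by
    rw [intervalIntegral.integral_eq_sub_of_hasDerivAt (f := fun x => -Real.log (1 + (s - x)))
      (fun x hx => ?_) (hc.intervalIntegrable _ _)]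
    · simp
    · rw [Set.uIcc_of_le hs.1] at hx
      rw [abs_of_nonneg (by linarith [hx.2])]
      have h := (((hasDerivAt_id x).const_sub s).const_add 1).log
        (by simp only [id]; linarith [hx.2])
      refine h.neg.congr_deriv ?_
      simp [neg_div]
  have h2 : ∫ s' in s..(a + R), (1 + |s - s'|)⁻¹ = Real.log (1 + (a + R - s)) := by
    rw [intervalIntegral.integral_eq_sub_of_hasDerivAt (f := fun x => Real.log (1 + (x - s)))
      (fun x hx => ?_) (hc.intervalIntegrable _ _)]
    · simp
    · rw [Set.uIcc_of_le hs.2] at hx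
      rw [abs_of_nonpos (by linarith [hx.1]), neg_sub]
      have h := (((hasDerivAt_id x).sub_const s).const_add 1).log
        (by simp only [id]; linarith [hx.1])
      refine h.congr_deriv ?_
      simp
  have h3 : ∀ y, 0 ≤ y → y ≤ R → Real.log (1 + y) ≤ 2 * Real.log R := by
    intro y hy0 hy
    rw [← Real.log_rpow (by linarith)]
    refine Real.log_le_log (by linarith) ?_
    rw [Real.rpow_two]
    nlinarith
  rw [h1, h2]
  linarith [h3 (s - a) (by linarith [hs.1]) (by linarith [hs.2]),
    h3 (a + R - s) (by linarith [hs.2]) (by linarith [hs.1])]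

/-! ### The Strichartz estimate for trigonometric polynomials -/

theorem norm_character {R : ℝ} (n : Fin 2 → ℤ) (y : Torus R) : ‖character R n y‖ = 1 := by
  simp only [character, ContinuousMap.coe_mk, norm_prod, fourier_apply, Circle.norm_coe,
    Finset.prod_const_one]

theorem character_sub {R : ℝ} (n : Fin 2 → ℤ) (x y : Torus R) :
    character R n (x - y) = character R n x * conj (character R n y) := by
  simp only [character, ContinuousMap.coe_mk, map_prod, ← Finset.prod_mul_distrib]
  refine Finset.prod_congr rfl fun i _ => ?_
  rw [Pi.sub_apply, fourier_apply, fourier_apply, fourier_apply, smul_sub, sub_eq_add_neg,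
    AddCircle.toCircle_add, AddCircle.toCircle_neg, Circle.coe_mul, Circle.coe_inv_eq_conj]

theorem exists_norm_tsum_character_le : ∃ C : ℝ, 0 < C ∧ ∀ (R : ℝ) [Fact (0 < R)], 2 ≤ R →
    ∀ (y : Torus R) (z : ℂ), 0 < z.re → |z.im| ≤ R →
      ‖∑' n, character R n y *
        (Complex.exp (-(z * bracket (freq R n))) / bracket (freq R n))‖ ≤
        C * R ^ 2 / (z.re * (1 + |z.im|)) := by
  obtain ⟨C, hC, h⟩ := exists_norm_tsum_planeWave_le
  refine ⟨C, hC, fun R _ hR y z hz him => ?_⟩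
  let x : Fin 2 → ℝ := fun i => AddCircle.equivIco R (-(R / 2)) (y i)
  have hx : ∀ i, |x i| ≤ R / 2 := fun i => by
    have := (AddCircle.equivIco R (-(R / 2)) (y i)).2
    exact abs_le.mpr ⟨this.1, by linarith [this.2]⟩
  have hy : y = fun i => (x i : AddCircle R) := funext fun i => AddCircle.coe_equivIco.symm
  rw [hy]
  simp only [character_coe]
  exact h R hR x hx z hz him

/-- The Klein-Gordon evolution of the trigonometric polynomial with coefficients `c`. -/
noncomputable def wave (R : ℝ) (S : Finset (Fin 2 → ℤ)) (c : (Fin 2 → ℤ) → ℂ) (s : ℝ) (x : Torus R) : ℂ :=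
  ∑ n ∈ S, c n * (Complex.exp (-Complex.I * s * bracket (freq R n)) * character R n x)

theorem continuous_wave (R : ℝ) (S : Finset (Fin 2 → ℤ)) (c : (Fin 2 → ℤ) → ℂ) :
    Continuous fun p : ℝ × Torus R => wave R S c p.1 p.2 := by
  unfold wave
  fun_prop

theorem norm_exp_neg_I_mul (s b : ℝ) : ‖Complex.exp (-Complex.I * s * b)‖ = 1 := by
  rw [show -Complex.I * s * b = ((-(s * b) : ℝ) : ℂ) * Complex.I by push_cast; ring]
  exact Complex.norm_exp_ofReal_mul_I _

/-- The estimate in `L²_t L^∞_x` on a time interval of length `R`, with the supremum in `x`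
replaced by the value along an arbitrary measurable trajectory. -/
theorem exists_integral_norm_wave_sq_le : ∃ C : ℝ, 0 < C ∧ ∀ (R : ℝ) [Fact (0 < R)], 2 ≤ R →
    ∀ (ε : ℝ), 0 < ε → ∀ (a : ℝ) (X : ℝ → Torus R), Measurable X →
    ∀ (S : Finset (Fin 2 → ℤ)) (c : (Fin 2 → ℤ) → ℂ),
      ∫ s in Set.Icc a (a + R), ‖wave R S c s (X s)‖ ^ 2 ≤
        C * R ^ 2 * Real.log R / ε * ∑ n ∈ S,
          ‖c n‖ ^ 2 * (bracket (freq R n) * Real.exp (ε * bracket (freq R n))) := by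
  obtain ⟨C, hC, hker⟩ := exists_norm_tsum_character_le
  refine ⟨4 * C, by positivity, fun R _ hR ε hε a X hX S c => ?_⟩
  have hR0 : 0 < R := Fact.out
  have hlog : 0 < Real.log R := Real.log_pos (by linarith)
  let w : (Fin 2 → ℤ) → ℝ := fun n =>
    Real.exp (-(ε * bracket (freq R n))) / bracket (freq R n)
  have hw : ∀ n, 0 < w n := fun n => div_pos (Real.exp_pos _) (bracket_pos _)
  have hws : Summable w := Summable.of_nonneg_of_le (fun n => (hw n).le)
    (fun n => div_le_self (Real.exp_pos _).le (one_le_bracket _))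
    (summable_exp_neg_mul_bracket hR0 hε)
  have hinv : ∀ u : ℝ, (1 + |u|)⁻¹ ≤ 1 := fun u => inv_le_one_of_one_le₀ (by
    linarith [abs_nonneg u])
  have key := integral_norm_sum_sq_le (μ := volume.restrict (Set.Icc a (a + R)))
    (T := Set.Icc a (a + R)) (ae_restrict_mem measurableSet_Icc)
    (v := fun n s => Complex.exp (-Complex.I * s * bracket (freq R n)) * character R n (X s))
    (fun n => Measurable.mul (by fun_prop) ((character R n).continuous.measurable.comp hX))
    (fun n s => by rw [norm_mul, norm_character, norm_exp_neg_I_mul, one_mul])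
    hw hws (κ := fun s s' => C * R ^ 2 / ε * (1 + |s - s'|)⁻¹)
    (A := 4 * C * R ^ 2 * Real.log R / ε) (B := C * R ^ 2 / ε) (by fun_prop)
    (fun s s' => by positivity)
    (fun s s' => mul_le_of_le_one_right (by positivity) (hinv _))
    (fun s s' => by rw [abs_sub_comm]) (by positivity)
    (fun s hs => by
      rw [integral_const_mul]
      calc _ ≤ C * R ^ 2 / ε * (4 * Real.log R) := by
            gcongr
            exact integral_inv_one_add_abs_sub_le hR hs
        _ = _ := by ring)
    (fun s hs s' hs' => by
      have h := hker R hR (X s - X s') (ε + Complex.I * (s - s' : ℝ)) (by simpa using hε)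
        (by
          simp only [Complex.add_im, Complex.ofReal_im, Complex.mul_im, Complex.I_re,
            Complex.I_im, Complex.ofReal_re, zero_mul, one_mul, zero_add]
          exact abs_le.mpr ⟨by linarith [hs.1, hs'.2], by linarith [hs.2, hs'.1]⟩)
      simp only [Complex.add_im, Complex.ofReal_im, Complex.mul_im, Complex.I_re,
            Complex.I_im, Complex.ofReal_re, zero_mul, one_mul, zero_add, Complex.add_re,
            Complex.mul_re, mul_zero, sub_zero, add_zero] at h
      refine le_of_eq_of_le ?_ (h.trans (le_of_eq (by field_simp)))
      congr 1
      refine tsum_congr fun n => ?_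
      rw [character_sub, map_mul, ← Complex.exp_conj]
      simp only [w, map_mul, map_neg, Complex.conj_I, Complex.conj_ofReal]
      push_cast
      have e : Complex.exp (-((ε + Complex.I * (s - s')) * bracket (freq R n))) =
          Complex.exp (-(ε * bracket (freq R n))) *
            Complex.exp (-Complex.I * s * bracket (freq R n)) *
            Complex.exp (- -Complex.I * s' * bracket (freq R n)) := by
        rw [← Complex.exp_add, ← Complex.exp_add]
        congr 1
        ring
      rw [e]
      ring)
    S c
  refine key.trans (le_of_eq ?_)
  congr 1
  refine Finset.sum_congr rfl fun n _ => ?_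
  have := (bracket_pos (freq R n)).ne'
  simp only [w]
  rw [Real.exp_neg]
  field_simp

/-- A bound along all measurable trajectories is a bound for the supremum over a sequence:
among finitely many points, one where `‖F s ·‖` is largest can be chosen measurably in `s`. -/
theorem lintegral_iSup_enorm_sq_le {X : Type*} [MeasurableSpace X] {F : ℝ → X → ℂ}
    (hF : Measurable fun p : ℝ × X => F p.1 p.2) (d : ℕ → X) {μ : Measure ℝ} {K : ℝ≥0∞}
    (h : ∀ x : ℝ → X, Measurable x → ∫⁻ s, ‖F s (x s)‖ₑ ^ 2 ∂μ ≤ K) :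
    ∫⁻ s, (⨆ j, ‖F s (d j)‖ₑ) ^ 2 ∂μ ≤ K := by
  classical
  have hFx : ∀ x : ℝ → X, Measurable x → Measurable fun s => F s (x s) := fun x hx =>
    hF.comp (measurable_id.prodMk hx)
  let x : ℕ → ℝ → X := fun J => Nat.rec (fun _ => d 0)
    (fun J y s => if ‖F s (y s)‖ₑ ≤ ‖F s (d (J + 1))‖ₑ then d (J + 1) else y s) J
  have x_succ : ∀ J s, x (J + 1) s =
      if ‖F s (x J s)‖ₑ ≤ ‖F s (d (J + 1))‖ₑ then d (J + 1) else x J s := fun J s => rfl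
  have hxm : ∀ J, Measurable (x J) := by
    intro J
    induction J with
    | zero => exact measurable_const
    | succ J ih =>
      exact Measurable.ite (measurableSet_le (hFx _ ih).enorm (hFx _ measurable_const).enorm)
        measurable_const ih
  have hxmono : ∀ s, Monotone fun J => ‖F s (x J s)‖ₑ := by
    intro s
    refine monotone_nat_of_le_succ fun J => ?_
    rw [x_succ]
    split_ifs with h'
    · exact h'
    · exact le_rfl
  have hxd : ∀ s J, ‖F s (d J)‖ₑ ≤ ‖F s (x J s)‖ₑ := by
    intro s J
    cases J with
    | zero => exact le_rfl
    | succ J =>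
      rw [x_succ]
      split_ifs with h'
      · exact le_rfl
      · exact (not_le.mp h').le
  calc ∫⁻ s, (⨆ j, ‖F s (d j)‖ₑ) ^ 2 ∂μ ≤ ∫⁻ s, ⨆ J, ‖F s (x J s)‖ₑ ^ 2 ∂μ := by
        refine lintegral_mono fun s => ?_
        rw [← ENNReal.iSup_pow]
        gcongr
        exact hxd s _
    _ = ⨆ J, ∫⁻ s, ‖F s (x J s)‖ₑ ^ 2 ∂μ :=
        lintegral_iSup (fun J => (hFx _ (hxm J)).enorm.pow_const 2)
          fun I J hIJ s => pow_le_pow_left₀ bot_le (hxmono s hIJ) 2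
    _ ≤ K := iSup_le fun J => h _ (hxm J)

/-- The interval `[0, t]` is covered by `⌊t / R⌋ + 1` intervals of length `R`. -/
theorem lintegral_Icc_le_of_forall_length {R t : ℝ} (hR : 0 < R) (ht : 0 ≤ t) {f : ℝ → ℝ≥0∞}
    {K : ℝ} (hK : 0 ≤ K) (h : ∀ a, ∫⁻ s in Set.Icc a (a + R), f s ≤ ENNReal.ofReal K) :
    ∫⁻ s in Set.Icc 0 t, f s ≤ ENNReal.ofReal ((1 + t / R) * K) := by
  set N := ⌊t / R⌋₊ + 1 with hN
  have hsub : Set.Icc 0 t ⊆ ⋃ i : Fin N, Set.Icc ((i : ℕ) * R) ((i : ℕ) * R + R) := by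
    intro s hs
    have h0 : 0 ≤ s / R := div_nonneg hs.1 hR.le
    refine Set.mem_iUnion.mpr ⟨⟨⌊s / R⌋₊, ?_⟩, ?_, ?_⟩
    · exact Nat.lt_succ_of_le (Nat.floor_le_floor (div_le_div_of_nonneg_right hs.2 hR.le))
    · exact (le_div_iff₀ hR).mp (Nat.floor_le h0)
    · have := (div_le_iff₀ hR).mp (Nat.lt_floor_add_one (s / R)).le
      simp only
      linarith
  calc ∫⁻ s in Set.Icc 0 t, f s
      ≤ ∫⁻ s, f s ∂(Measure.sum fun i : Fin N =>
          volume.restrict (Set.Icc ((i : ℕ) * R) ((i : ℕ) * R + R))) :=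
        lintegral_mono' ((Measure.restrict_mono hsub le_rfl).trans
          Measure.restrict_iUnion_le) le_rfl
    _ ≤ ∑ i : Fin N, ENNReal.ofReal K := by
        rw [lintegral_sum_measure, tsum_fintype]
        exact Finset.sum_le_sum fun i _ => h _
    _ = ENNReal.ofReal (N * K) := by
        rw [Finset.sum_const, Finset.card_univ, Fintype.card_fin, nsmul_eq_mul,
          ENNReal.ofReal_mul (by positivity), ENNReal.ofReal_natCast]
    _ ≤ _ := by
        refine ENNReal.ofReal_le_ofReal (mul_le_mul_of_nonneg_right ?_ hK)
        have := Nat.floor_le (div_nonneg ht hR.le)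
        rw [hN]
        push_cast
        linarith

/-- The Strichartz estimate in `L²_t L^∞_x` for trigonometric polynomials. -/
theorem exists_lintegral_iSup_wave_le : ∃ C : ℝ, 0 < C ∧ ∀ (R : ℝ) [Fact (0 < R)], 2 ≤ R →
    ∀ (ε : ℝ), 0 < ε → ∀ t : ℝ, 0 ≤ t → ∀ (d : ℕ → Torus R)
    (S : Finset (Fin 2 → ℤ)) (c : (Fin 2 → ℤ) → ℂ),
      ∫⁻ s in Set.Icc 0 t, (⨆ j, ‖wave R S c s (d j)‖ₑ) ^ 2 ≤
        ENNReal.ofReal ((1 + t / R) * (C * R ^ 2 * Real.log R / ε * ∑ n ∈ S,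
          ‖c n‖ ^ 2 * (bracket (freq R n) * Real.exp (ε * bracket (freq R n))))) := by
  obtain ⟨C, hC, h⟩ := exists_integral_norm_wave_sq_le
  refine ⟨C, hC, fun R _ hR ε hε t ht d S c => ?_⟩
  have hR0 : 0 < R := Fact.out
  have hlog : 0 < Real.log R := Real.log_pos (by linarith)
  have hm : Measurable fun p : ℝ × Torus R => wave R S c p.1 p.2 :=
    (continuous_wave R S c).measurable
  refine lintegral_Icc_le_of_forall_length hR0 ht ?_ fun a => ?_
  · have : ∀ n, 0 < bracket (freq R n) := fun n => bracket_pos _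
    refine mul_nonneg (by positivity) (Finset.sum_nonneg fun n _ => ?_)
    have := this n
    positivity
  · refine lintegral_iSup_enorm_sq_le hm d fun x hx => ?_
    refine le_of_eq_of_le ?_ (ENNReal.ofReal_le_ofReal (h R hR ε hε a x hx S c))
    have hsx : Measurable fun s => (s, x s) := measurable_id.prodMk hx
    have hmx : Measurable fun s => wave R S c s (x s) := by
      have h' := hm.comp hsx
      simpa only [Function.comp_def] using h'
    have hb : ∀ s, ‖wave R S c s (x s)‖ ≤ ∑ n ∈ S, ‖c n‖ := fun s =>
      (norm_sum_le _ _).trans (Finset.sum_le_sum fun n _ => by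
        rw [norm_mul, norm_mul, norm_character, norm_exp_neg_I_mul, one_mul, mul_one])
    have hi : Integrable (fun s => ‖wave R S c s (x s)‖ ^ 2)
        (volume.restrict (Set.Icc a (a + R))) := by
      refine Integrable.of_bound (hmx.norm.pow_const 2).aestronglyMeasurable
        ((∑ n ∈ S, ‖c n‖) ^ 2) (Filter.Eventually.of_forall fun s => ?_)
      rw [norm_pow, norm_norm]
      exact pow_le_pow_left₀ (norm_nonneg _) (hb s) 2
    rw [ofReal_integral_eq_lintegral_ofReal hi (ae_of_all _ fun s => sq_nonneg _)]
    refine lintegral_congr fun s => ?_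
    rw [ENNReal.ofReal_pow (norm_nonneg _), ofReal_norm]

/-! ### Littlewood-Paley pieces -/

theorem IsCutoff.exists_abs_dyadic_le {φ : Freq → ℝ} (hφ : IsCutoff φ) :
    ∃ B : ℝ, 0 < B ∧ ∀ k ξ, |dyadic φ k ξ| ≤ B := by
  obtain ⟨B, hB⟩ := (isCompact_closedBall (0 : Freq) (3 / 2)).exists_bound_of_continuousOn
    hφ.smooth.continuous.continuousOn
  have hφB : ∀ ξ, |φ ξ| ≤ max B 1 := by
    intro ξ
    by_cases h : ξ ∈ Metric.ball (0 : Freq) (3 / 2)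
    · exact (hB ξ (Metric.ball_subset_closedBall h)).trans (le_max_left _ _)
    · rw [hφ.eq_zero ξ h, abs_zero]
      positivity
  refine ⟨max B 1 + max B 1, by positivity, fun k ξ => ?_⟩
  exact (abs_sub _ _).trans (add_le_add (hφB _) (hφB _))

theorem IsCutoff.norm_bounds_of_dyadic_ne_zero {φ : Freq → ℝ} (hφ : IsCutoff φ) {k : ℤ} {ξ : Freq}
    (h : dyadic φ k ξ ≠ 0) : (2 : ℝ) ^ k ≤ 3 * ‖ξ‖ ∧ ‖ξ‖ < 3 / 2 * 2 ^ k := by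
  have hk : (0 : ℝ) < 2 ^ k := by positivity
  have hk' : (2 : ℝ) ^ k = 2 * 2 ^ (k - 1) := by
    rw [← zpow_one_add₀ two_ne_zero, add_sub_cancel]
  have hk1 : (0 : ℝ) < 2 ^ (k - 1) := by positivity
  have hnorm : ∀ r : ℝ, 0 < r → ‖r⁻¹ • ξ‖ = ‖ξ‖ / r := fun r hr => by
    rw [norm_smul, norm_inv, Real.norm_of_nonneg hr.le, inv_mul_eq_div]
  constructor
  · by_contra! hlt
    refine h ?_
    rw [dyadic, hφ.eq_one, hφ.eq_one, sub_self]
    · rw [mem_ball_zero_iff, hnorm _ hk1, div_lt_iff₀ hk1]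
      linarith
    · rw [mem_ball_zero_iff, hnorm _ hk, div_lt_iff₀ hk]
      linarith
  · by_contra! hle
    refine h ?_
    rw [dyadic, hφ.eq_zero, hφ.eq_zero, sub_self]
    · rw [mem_ball_zero_iff, hnorm _ hk1, not_lt, le_div_iff₀ hk1]
      linarith
    · rw [mem_ball_zero_iff, hnorm _ hk, not_lt, le_div_iff₀ hk]
      linarith

theorem zpow_le_pow_toNat (k : ℤ) : (2 : ℝ) ^ k ≤ 2 ^ (max k 0).toNat := by
  rw [← zpow_natCast, Int.toNat_of_nonneg (le_max_right k 0)]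
  exact zpow_le_zpow_right₀ one_le_two (le_max_left k 0)

theorem IsCutoff.bracket_le_of_dyadic_ne_zero {φ : Freq → ℝ} (hφ : IsCutoff φ) {k : ℤ} {ξ : Freq}
    (h : dyadic φ k ξ ≠ 0) : bracket ξ ≤ 3 * 2 ^ (max k 0).toNat := by
  have h1 := (hφ.norm_bounds_of_dyadic_ne_zero h).2
  have h2 := zpow_le_pow_toNat k
  have h3 : (1 : ℝ) ≤ 2 ^ (max k 0).toNat := one_le_pow₀ one_le_two
  have h4 : bracket ξ ≤ 1 + ‖ξ‖ :=
    Real.sqrt_le_iff.mpr ⟨by positivity, by nlinarith [norm_nonneg ξ]⟩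
  linarith

theorem IsCutoff.pow_le_of_dyadic_ne_zero {φ : Freq → ℝ} (hφ : IsCutoff φ) {k : ℤ} {ξ : Freq}
    (h : dyadic φ k ξ ≠ 0) : (4 : ℝ) ^ (max k 0).toNat ≤ 9 * (1 + ‖ξ‖ ^ 2) := by
  rcases le_or_gt k 0 with hk | hk
  · rw [max_eq_right hk]
    simp only [Int.toNat_zero, pow_zero]
    nlinarith [sq_nonneg ‖ξ‖]
  · have h1 := (hφ.norm_bounds_of_dyadic_ne_zero h).1
    have h2 : (2 : ℝ) ^ (max k 0).toNat = 2 ^ k := by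
      rw [← zpow_natCast, Int.toNat_of_nonneg (le_max_right k 0), max_eq_left hk.le]
    have h3 : (4 : ℝ) ^ (max k 0).toNat = (2 ^ (max k 0).toNat) ^ 2 := by
      rw [← pow_mul, mul_comm, pow_mul]
      norm_num
    rw [h3, h2]
    have : (0 : ℝ) < 2 ^ k := by positivity
    nlinarith

/-- Every nonzero frequency meets at most three dyadic annuli. -/
theorem IsCutoff.exists_mem_Icc_of_dyadic_ne_zero {φ : Freq → ℝ} (hφ : IsCutoff φ) (ξ : Freq) :
    ∃ j : ℤ, ∀ k, dyadic φ k ξ ≠ 0 → k ∈ Finset.Icc (j - 2) j := by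
  rcases (norm_nonneg ξ).eq_or_lt with h0 | h0
  · refine ⟨0, fun k hk => ?_⟩
    have h1 := (hφ.norm_bounds_of_dyadic_ne_zero hk).1
    have h2 : (0 : ℝ) < 2 ^ k := by positivity
    rw [← h0] at h1
    linarith
  · obtain ⟨j, hj1, hj2⟩ := exists_mem_Ico_zpow (by positivity : 0 < 3 * ‖ξ‖) one_lt_two
    refine ⟨j, fun k hk => ?_⟩
    obtain ⟨h1, h2⟩ := hφ.norm_bounds_of_dyadic_ne_zero hk
    have h3 : k < j + 1 := (zpow_lt_zpow_iff_right₀ one_lt_two).mp (h1.trans_lt hj2)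
    have h4 : (2 : ℝ) ^ j < 2 ^ (k + 3) := by
      rw [zpow_add₀ two_ne_zero]
      have : (0 : ℝ) < 2 ^ k := by positivity
      norm_num
      linarith
    have h5 : j < k + 3 := (zpow_lt_zpow_iff_right₀ one_lt_two).mp h4
    rw [Finset.mem_Icc]
    omega

theorem abs_freq_le (R : ℝ) (n : Fin 2 → ℤ) (i : Fin 2) :
    |2 * Real.pi * n i / R| ≤ ‖freq R n‖ := by
  have := PiLp.norm_apply_le (freq R n) i
  rwa [Real.norm_eq_abs] at this

theorem finite_setOf_norm_freq_lt {R : ℝ} (hR : 0 < R) (r : ℝ) :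
    {n : Fin 2 → ℤ | ‖freq R n‖ < r}.Finite := by
  refine (Set.finite_Icc (fun _ : Fin 2 => -⌈r * R⌉) (fun _ => ⌈r * R⌉)).subset fun n hn => ?_
  have h : ∀ i, |n i| ≤ ⌈r * R⌉ := fun i => by
    have h1 := (abs_freq_le R n i).trans hn.le
    rw [abs_div, abs_mul, abs_of_pos hR, abs_of_pos (by positivity : 0 < 2 * Real.pi),
      div_le_iff₀ hR] at h1
    have h2 : |(n i : ℝ)| ≤ 2 * Real.pi * |(n i : ℝ)| :=
      le_mul_of_one_le_left (abs_nonneg _) (by linarith [Real.pi_gt_three])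
    have h3 := h2.trans (h1.trans (Int.le_ceil _))
    exact_mod_cast h3
  exact ⟨fun i => (abs_le.mp (h i)).1, fun i => (abs_le.mp (h i)).2⟩

theorem le_norm_freq_of_ne_zero {R : ℝ} (hR : 0 < R) {n : Fin 2 → ℤ} (hn : n ≠ 0) :
    6 / R ≤ ‖freq R n‖ := by
  obtain ⟨i, hi⟩ := Function.ne_iff.mp hn
  refine le_trans ?_ (abs_freq_le R n i)
  have h1 : (1 : ℝ) ≤ |(n i : ℝ)| := by exact_mod_cast Int.one_le_abs hi
  rw [abs_div, abs_mul, abs_of_pos hR, abs_of_pos (by positivity : 0 < 2 * Real.pi)]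
  gcongr
  nlinarith [Real.pi_gt_three]

/-- The zero frequency is annihilated by every `P_k`, and the others are at least `6 / R`, so
that only the annuli with `2 ^ k > 1 / R` matter. -/
theorem IsCutoff.one_lt_of_dyadic_freq_ne_zero {φ : Freq → ℝ} (hφ : IsCutoff φ) {R : ℝ}
    (hR : 0 < R) {k : ℤ} {n : Fin 2 → ℤ} (h : dyadic φ k (freq R n) ≠ 0) : 1 < R * 2 ^ k := by
  obtain ⟨h1, h2⟩ := hφ.norm_bounds_of_dyadic_ne_zero h
  have hn : n ≠ 0 := by
    rintro rfl
    have h3 : ‖freq R 0‖ ^ 2 = 0 := by simp [norm_freq_sq]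
    rw [pow_eq_zero_iff two_ne_zero] at h3
    have h4 : (0 : ℝ) < 2 ^ k := by positivity
    rw [h3] at h1
    linarith
  have h3 := (le_norm_freq_of_ne_zero hR hn).trans h2.le
  rw [div_le_iff₀ hR] at h3
  linarith

theorem eLpNorm_top_toLp_le {R : ℝ} [Fact (0 < R)] (f : C(Torus R, ℂ)) {d : ℕ → Torus R}
    (hd : DenseRange d) :
    eLpNorm (ContinuousMap.toLp 2 (volume : Measure (Torus R)) ℂ f) ∞
      (volume : Measure (Torus R)) ≤ ⨆ j, ‖f (d j)‖ₑ := by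
  rw [eLpNorm_congr_ae (ContinuousMap.coeFn_toLp (p := 2) (𝕜 := ℂ) _ f), eLpNorm_exponent_top]
  refine essSup_le_of_ae_le _ (Filter.Eventually.of_forall fun x => ?_)
  exact hd.induction_on (p := fun x => ‖f x‖ₑ ≤ ⨆ j, ‖f (d j)‖ₑ) x
    (isClosed_le (by fun_prop) continuous_const) fun j => le_iSup (fun j => ‖f (d j)‖ₑ) j

theorem proj_flow_eq {φ : Freq → ℝ} {R : ℝ} [Fact (0 < R)] {k : ℤ}
    {S : Finset (Fin 2 → ℤ)} (hS : ∀ n, dyadic φ k (freq R n) ≠ 0 → n ∈ S) (s : ℝ) (u : L2 R) :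
    proj φ k (flow s u) = ContinuousMap.toLp 2 (volume : Measure (Torus R)) ℂ
      (∑ n ∈ S, (dyadic φ k (freq R n) * coeff u n *
        Complex.exp (-Complex.I * s * bracket (freq R n))) • character R n) := by
  have hc : ∀ n, coeff (flow s u) n =
      Complex.exp (-Complex.I * s * bracket (freq R n)) * coeff u n := fun n =>
    coeff_multiplier (B := 1) (fun ξ => (norm_exp_neg_I_mul s (bracket ξ)).le) u n
  rw [proj, multiplier, tsum_eq_sum (s := S), map_sum]
  · refine Finset.sum_congr rfl fun n _ => ?_
    rw [map_smul, hc, characterL2]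
    congr 1
    ring
  · intro n hn
    have : dyadic φ k (freq R n) = 0 := by
      by_contra h
      exact hn (hS n h)
    simp [this]

theorem eLpNorm_proj_flow_le {φ : Freq → ℝ} {R : ℝ} [Fact (0 < R)]
    {k : ℤ} {S : Finset (Fin 2 → ℤ)} (hS : ∀ n, dyadic φ k (freq R n) ≠ 0 → n ∈ S) (s : ℝ)
    (u : L2 R) {d : ℕ → Torus R} (hd : DenseRange d) :
    eLpNorm (proj φ k (flow s u)) ∞ (volume : Measure (Torus R)) ≤
      ⨆ j, ‖wave R S (fun n => dyadic φ k (freq R n) * coeff u n) s (d j)‖ₑ := by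
  rw [proj_flow_eq hS s u]
  refine (eLpNorm_top_toLp_le _ hd).trans (le_of_eq ?_)
  refine iSup_congr fun j => ?_
  rw [wave, ContinuousMap.sum_apply]
  congr 1
  refine Finset.sum_congr rfl fun n _ => ?_
  rw [ContinuousMap.smul_apply, smul_eq_mul, mul_assoc]

/-! ### Summation over the dyadic pieces -/

theorem sq_tsum_mul_le {ι : Type*} [Countable ι] (f g : ι → ℝ≥0∞) :
    (∑' i, f i * g i) ^ 2 ≤ (∑' i, f i ^ 2) * ∑' i, g i ^ 2 := by
  let _ : MeasurableSpace ι := ⊤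
  have hpq : (2 : ℝ).HolderConjugate 2 := Real.HolderConjugate.two_two
  have h := ENNReal.lintegral_mul_le_Lp_mul_Lq (Measure.count : Measure ι) hpq
    (f := f) (g := g) (measurable_from_top.aemeasurable) (measurable_from_top.aemeasurable)
  simp only [lintegral_count, Pi.mul_apply] at h
  rw [← ENNReal.mul_rpow_of_nonneg _ _ (by norm_num)] at h
  have h2 := ENNReal.rpow_le_rpow h (by norm_num : (0 : ℝ) ≤ 2)
  rw [← ENNReal.rpow_mul] at h2
  simpa only [ENNReal.rpow_two, one_div, inv_mul_cancel₀ (two_ne_zero' ℝ), ENNReal.rpow_one]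
    using h2

/-- Only about `log R` of the low frequency annuli contribute. -/
theorem tsum_dyadic_weight_le {R : ℝ} (hR : 2 ≤ R) :
    ∑' k : ℤ, (if 1 < R * 2 ^ k then ((2 : ℝ≥0∞) ^ (max k 0).toNat)⁻¹ else 0) ^ 2 ≤
      ENNReal.ofReal (4 * Real.log R) := by
  have hR0 : 0 < R := by linarith
  have hl2 : 0 < Real.log 2 := Real.log_pos one_lt_two
  have hlR : Real.log 2 ≤ Real.log R := Real.log_le_log two_pos hR
  set N := ⌊Real.log R / Real.log 2⌋₊ with hN
  rw [tsum_of_nat_of_neg_add_one ENNReal.summable ENNReal.summable]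
  have h1 : ∑' n : ℕ, (if 1 < R * 2 ^ (n : ℤ) then
      ((2 : ℝ≥0∞) ^ (max (n : ℤ) 0).toNat)⁻¹ else 0) ^ 2 ≤ ENNReal.ofReal (4 / 3) := by
    calc _ ≤ ∑' n : ℕ, (ENNReal.ofReal (1 / 4)) ^ n := by
          refine ENNReal.tsum_le_tsum fun n => ?_
          have e : (((2 : ℝ≥0∞) ^ n)⁻¹) ^ 2 = (ENNReal.ofReal (1 / 4)) ^ n := by
            rw [← ENNReal.inv_pow, ← pow_mul, mul_comm, pow_mul]
            rw [one_div, ENNReal.ofReal_inv_of_pos (by norm_num), ENNReal.ofReal_ofNat,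
              ← ENNReal.inv_pow]
            norm_num
          rw [max_eq_left (Int.natCast_nonneg n), Int.toNat_natCast]
          split_ifs
          · exact e.le
          · simp
      _ = ENNReal.ofReal (4 / 3) := by
          rw [ENNReal.tsum_geometric, ← ENNReal.ofReal_one, ← ENNReal.ofReal_sub _ (by norm_num),
            ← ENNReal.ofReal_inv_of_pos (by norm_num)]
          norm_num
  have h2 : ∑' n : ℕ, (if 1 < R * 2 ^ (-((n : ℤ) + 1)) then
      ((2 : ℝ≥0∞) ^ (max (-((n : ℤ) + 1)) 0).toNat)⁻¹ else 0) ^ 2 ≤ (N : ℝ≥0∞) := by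
    rw [tsum_eq_sum (s := Finset.range N)]
    · calc _ ≤ ∑ n ∈ Finset.range N, (1 : ℝ≥0∞) := by
            refine Finset.sum_le_sum fun n _ => ?_
            rw [max_eq_right (by omega)]
            split_ifs <;> simp
        _ = N := by simp
    · intro n hn
      rw [if_neg, zero_pow two_ne_zero]
      intro hlt
      refine hn (Finset.mem_range.mpr (Nat.lt_of_succ_le (Nat.le_floor ?_)))
      have h3 : (2 : ℝ) ^ (n + 1) < R := by
        rw [zpow_neg, ← div_eq_mul_inv, one_lt_div (by positivity)] at hlt
        exact_mod_cast hlt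
      rw [le_div_iff₀ hl2, ← Real.log_pow]
      exact Real.log_le_log (by positivity) h3.le
  refine (add_le_add h1 h2).trans ?_
  rw [← ENNReal.ofReal_natCast, ← ENNReal.ofReal_add (by norm_num) (by positivity)]
  refine ENNReal.ofReal_le_ofReal ?_
  have h3 : (N : ℝ) ≤ Real.log R / Real.log 2 :=
    Nat.floor_le (div_nonneg (hl2.le.trans hlR) hl2.le)
  have h4 : Real.log R / Real.log 2 ≤ 3 / 2 * Real.log R := by
    rw [div_le_iff₀ hl2]
    nlinarith [Real.log_two_gt_d9]
  linarith [Real.log_two_gt_d9]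

/-- The Strichartz estimate for a single Littlewood-Paley piece, with a measurable majorant of
its `L^∞` norm. -/
theorem IsCutoff.exists_strichartz {φ : Freq → ℝ} (hφ : IsCutoff φ) :
    ∃ C : ℝ, 0 < C ∧ ∀ (R : ℝ) [Fact (0 < R)], 2 ≤ R → ∀ t : ℝ, 0 ≤ t → ∀ (u : L2 R) (k : ℤ),
      ∃ m : ℝ → ℝ≥0∞, Measurable m ∧
        (∀ s, eLpNorm (proj φ k (flow s u)) ∞ (volume : Measure (Torus R)) ≤ m s) ∧
        (¬ 1 < R * 2 ^ k → ∀ s, m s = 0) ∧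
        ∫⁻ s in Set.Icc 0 t, m s ^ 2 ≤ ENNReal.ofReal (C * Real.log R * (1 + t / R)) *
          ∑' n, ENNReal.ofReal (R ^ 2 * 4 ^ (max k 0).toNat *
            (dyadic φ k (freq R n) ^ 2 * ‖coeff u n‖ ^ 2)) := by
  obtain ⟨C, hC, hst⟩ := exists_lintegral_iSup_wave_le
  refine ⟨C * (3 * Real.exp 3), by positivity, fun R _ hR t ht u k => ?_⟩
  have hR0 : 0 < R := Fact.out
  have hlog : 0 < Real.log R := Real.log_pos (by linarith)
  obtain ⟨d, hd⟩ := TopologicalSpace.exists_dense_seq (Torus R)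
  have hfin : {n : Fin 2 → ℤ | dyadic φ k (freq R n) ≠ 0}.Finite :=
    (finite_setOf_norm_freq_lt hR0 _).subset fun n hn =>
      (hφ.norm_bounds_of_dyadic_ne_zero hn).2
  set S := hfin.toFinset with hSdef
  have hS : ∀ n, dyadic φ k (freq R n) ≠ 0 ↔ n ∈ S := fun n => by simp [hSdef]
  set c : (Fin 2 → ℤ) → ℂ := fun n => dyadic φ k (freq R n) * coeff u n with hc
  set p : ℝ := 2 ^ (max k 0).toNat with hp
  have hp0 : 0 < p := by positivity
  have hp2 : (4 : ℝ) ^ (max k 0).toNat = p * p := by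
    rw [hp, ← mul_pow]
    norm_num
  refine ⟨fun s => ⨆ j, ‖wave R S c s (d j)‖ₑ, ?_, ?_, ?_, ?_⟩
  · refine Measurable.iSup fun j => Measurable.enorm (Continuous.measurable ?_)
    unfold wave
    fun_prop
  · exact fun s => eLpNorm_proj_flow_le (fun n => (hS n).mp) s u hd
  · intro hk s
    have hSe : S = ∅ := Finset.eq_empty_of_forall_notMem fun n hn =>
      hk (hφ.one_lt_of_dyadic_freq_ne_zero hR0 ((hS n).mpr hn))
    simp [hSe, wave]
  · refine (hst R hR p⁻¹ (inv_pos.mpr hp0) t ht d S c).trans ?_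
    have hterm : ∀ n ∈ S, ‖c n‖ ^ 2 *
        (bracket (freq R n) * Real.exp (p⁻¹ * bracket (freq R n))) ≤
        3 * Real.exp 3 * p * (dyadic φ k (freq R n) ^ 2 * ‖coeff u n‖ ^ 2) := by
      intro n hn
      have h1 := hφ.bracket_le_of_dyadic_ne_zero ((hS n).mpr hn)
      rw [← hp] at h1
      have h2 : p⁻¹ * bracket (freq R n) ≤ 3 := by
        rw [inv_mul_le_iff₀ hp0]
        linarith
      have h3 : ‖c n‖ ^ 2 = dyadic φ k (freq R n) ^ 2 * ‖coeff u n‖ ^ 2 := by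
        rw [hc, norm_mul, mul_pow, Complex.norm_real, Real.norm_eq_abs, sq_abs]
      have h4 : bracket (freq R n) * Real.exp (p⁻¹ * bracket (freq R n)) ≤
          3 * p * Real.exp 3 := by
        gcongr
      rw [h3, mul_comm]
      refine (mul_le_mul_of_nonneg_right h4 (by positivity)).trans (le_of_eq ?_)
      ring
    calc _ ≤ ENNReal.ofReal ((1 + t / R) * (C * R ^ 2 * Real.log R / p⁻¹ * ∑ n ∈ S,
            3 * Real.exp 3 * p * (dyadic φ k (freq R n) ^ 2 * ‖coeff u n‖ ^ 2))) := by
          refine ENNReal.ofReal_le_ofReal ?_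
          have := Finset.sum_le_sum hterm
          gcongr
      _ = ENNReal.ofReal (C * (3 * Real.exp 3) * Real.log R * (1 + t / R)) *
          ∑ n ∈ S, ENNReal.ofReal (R ^ 2 * 4 ^ (max k 0).toNat *
            (dyadic φ k (freq R n) ^ 2 * ‖coeff u n‖ ^ 2)) := by
          rw [← ENNReal.ofReal_sum_of_nonneg fun n _ => by positivity,
            ← ENNReal.ofReal_mul (by positivity), ← Finset.mul_sum, ← Finset.mul_sum, hp2]
          congr 1
          rw [div_inv_eq_mul]
          ring
      _ ≤ _ := by
          gcongr
          exact ENNReal.sum_le_tsum S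

/-- Almost orthogonality of the Littlewood-Paley pieces in `H^s`. -/
theorem IsCutoff.exists_tsum_dyadic_le {φ : Freq → ℝ} (hφ : IsCutoff φ) (r : ℕ) :
    ∃ C : ℝ, 0 < C ∧ ∀ (R : ℝ) [Fact (0 < R)] (u : L2 R) (n : Fin 2 → ℤ),
      ∑' k : ℤ, ENNReal.ofReal (R ^ 2 * 4 ^ (r * (max k 0).toNat) *
        (dyadic φ k (freq R n) ^ 2 * ‖coeff u n‖ ^ 2)) ≤
      ENNReal.ofReal C *
        ENNReal.ofReal (R ^ 2 * (1 + ‖freq R n‖ ^ 2) ^ r * ‖coeff u n‖ ^ 2) := by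
  obtain ⟨B, hB, hφB⟩ := hφ.exists_abs_dyadic_le
  refine ⟨3 * 9 ^ r * B ^ 2, by positivity, fun R _ u n => ?_⟩
  obtain ⟨j, hj⟩ := hφ.exists_mem_Icc_of_dyadic_ne_zero (freq R n)
  rw [tsum_eq_sum (s := Finset.Icc (j - 2) j), ← ENNReal.ofReal_sum_of_nonneg
    fun k _ => by positivity, ← ENNReal.ofReal_mul (by positivity)]
  · refine ENNReal.ofReal_le_ofReal ?_
    have hterm : ∀ k ∈ Finset.Icc (j - 2) j, R ^ 2 * 4 ^ (r * (max k 0).toNat) *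
        (dyadic φ k (freq R n) ^ 2 * ‖coeff u n‖ ^ 2) ≤
        9 ^ r * B ^ 2 * (R ^ 2 * (1 + ‖freq R n‖ ^ 2) ^ r * ‖coeff u n‖ ^ 2) := by
      intro k _
      by_cases h : dyadic φ k (freq R n) = 0
      · rw [h]
        simp only [ne_eq, two_ne_zero, not_false_eq_true, zero_pow, zero_mul, mul_zero]
        positivity
      · have h1 := hφ.pow_le_of_dyadic_ne_zero h
        have h2 : (4 : ℝ) ^ (r * (max k 0).toNat) ≤ (9 * (1 + ‖freq R n‖ ^ 2)) ^ r := by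
          rw [mul_comm, pow_mul]
          gcongr
        have h3 : dyadic φ k (freq R n) ^ 2 ≤ B ^ 2 := sq_le_sq' (abs_le.mp (hφB k _)).1
          (abs_le.mp (hφB k _)).2
        calc _ ≤ R ^ 2 * (9 * (1 + ‖freq R n‖ ^ 2)) ^ r * (B ^ 2 * ‖coeff u n‖ ^ 2) := by
              gcongr
          _ = _ := by
              rw [mul_pow]
              ring
    refine (Finset.sum_le_card_nsmul _ _ _ hterm).trans (le_of_eq ?_)
    rw [Int.card_Icc, show (j + 1 - (j - 2)).toNat = 3 by omega, nsmul_eq_mul]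
    push_cast
    ring
  · intro k hk
    have : dyadic φ k (freq R n) = 0 := by
      by_contra h
      exact hk (hj k h)
    simp [this]

theorem lintegral_normX_sq_le {φ : Freq → ℝ} (hφ : IsCutoff φ) (M : ℕ) :
    ∃ C : ℝ, 0 < C ∧ ∀ (R : ℝ) [Fact (0 < R)], 2 ≤ R → ∀ t : ℝ, 0 ≤ t → ∀ u : L2 R,
      ∫⁻ s in Set.Icc 0 t, normX φ M (flow s u) ^ 2 ≤
        ENNReal.ofReal (C * Real.log R ^ 2 * (1 + t / R)) *
          ∑' n, ENNReal.ofReal (R ^ 2 * (1 + ‖freq R n‖ ^ 2) ^ (M + 2) * ‖coeff u n‖ ^ 2) := by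
  obtain ⟨C₁, hC₁, hst⟩ := hφ.exists_strichartz
  obtain ⟨C₂, hC₂, horth⟩ := hφ.exists_tsum_dyadic_le (M + 2)
  refine ⟨4 * C₁ * C₂, by positivity, fun R _ hR t ht u => ?_⟩
  have hR0 : 0 < R := Fact.out
  have hlog : 0 < Real.log R := Real.log_pos (by linarith)
  choose m hm hmle hm0 hmI using hst R hR t ht u
  let β : ℤ → ℝ≥0∞ := fun k => if 1 < R * 2 ^ k then ((2 : ℝ≥0∞) ^ (max k 0).toNat)⁻¹ else 0
  let a : ℤ → ℝ≥0∞ := fun k => (2 : ℝ≥0∞) ^ ((M + 1) * (max k 0).toNat)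
  have hβ : ∀ k s, (2 : ℝ≥0∞) ^ (M * (max k 0).toNat) * m k s = β k * (a k * m k s) := by
    intro k s
    by_cases hk : 1 < R * 2 ^ k
    · simp only [β, a, if_pos hk]
      rw [add_mul, one_mul, add_comm, pow_add, ← mul_assoc, ← mul_assoc,
        ENNReal.inv_mul_cancel (pow_ne_zero _ two_ne_zero) (by finiteness), one_mul]
    · rw [hm0 k hk s]
      simp
  have hpt : ∀ s, normX φ M (flow s u) ^ 2 ≤
      ENNReal.ofReal (4 * Real.log R) * ∑' k, (a k * m k s) ^ 2 := by
    intro s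
    calc normX φ M (flow s u) ^ 2 ≤ (∑' k, β k * (a k * m k s)) ^ 2 := by
          refine pow_le_pow_left₀ bot_le (ENNReal.tsum_le_tsum fun k => ?_) 2
          rw [← hβ]
          gcongr
          exact hmle k s
      _ ≤ (∑' k, β k ^ 2) * ∑' k, (a k * m k s) ^ 2 := sq_tsum_mul_le _ _
      _ ≤ _ := by
          gcongr
          exact tsum_dyadic_weight_le hR
  have ha : ∀ k, a k ^ 2 = ENNReal.ofReal (4 ^ ((M + 1) * (max k 0).toNat)) := fun k => by
    simp only [a]
    rw [← pow_mul, mul_comm _ 2, pow_mul, ENNReal.ofReal_pow (by norm_num)]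
    congr 1
    norm_num
  calc ∫⁻ s in Set.Icc 0 t, normX φ M (flow s u) ^ 2
      ≤ ∫⁻ s in Set.Icc 0 t, ENNReal.ofReal (4 * Real.log R) * ∑' k, (a k * m k s) ^ 2 :=
        lintegral_mono hpt
    _ = ENNReal.ofReal (4 * Real.log R) *
          ∑' k, a k ^ 2 * ∫⁻ s in Set.Icc 0 t, m k s ^ 2 := by
        rw [lintegral_const_mul' _ _ ENNReal.ofReal_ne_top, lintegral_tsum fun k =>
          (((hm k).const_mul _).pow_const 2).aemeasurable]
        congr 1
        refine tsum_congr fun k => ?_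
        simp only [mul_pow]
        rw [lintegral_const_mul _ ((hm k).pow_const 2)]
    _ ≤ ENNReal.ofReal (4 * Real.log R) *
          ∑' k, ENNReal.ofReal (C₁ * Real.log R * (1 + t / R)) *
            ∑' n, ENNReal.ofReal (R ^ 2 * 4 ^ ((M + 2) * (max k 0).toNat) *
              (dyadic φ k (freq R n) ^ 2 * ‖coeff u n‖ ^ 2)) := by
        refine mul_le_mul_right (ENNReal.tsum_le_tsum fun k => ?_) _
        refine (mul_le_mul_right (hmI k) _).trans (le_of_eq ?_)
        rw [mul_left_comm, ← ENNReal.tsum_mul_left, ha]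
        congr 1
        refine tsum_congr fun n => ?_
        rw [← ENNReal.ofReal_mul (by positivity)]
        congr 1
        rw [show M + 2 = M + 1 + 1 from rfl, add_mul (M + 1), one_mul, pow_add]
        ring
    _ ≤ ENNReal.ofReal (4 * Real.log R) * (ENNReal.ofReal (C₁ * Real.log R * (1 + t / R)) *
          (ENNReal.ofReal C₂ * ∑' n, ENNReal.ofReal
            (R ^ 2 * (1 + ‖freq R n‖ ^ 2) ^ (M + 2) * ‖coeff u n‖ ^ 2))) := by
        rw [ENNReal.tsum_mul_left, ENNReal.tsum_comm, ← ENNReal.tsum_mul_left (a := .ofReal C₂)]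
        gcongr with n
        exact horth R u n
    _ = _ := by
        rw [← mul_assoc, ← mul_assoc, ← ENNReal.ofReal_mul (by positivity),
          ← ENNReal.ofReal_mul (by positivity)]
        congr 2
        ring

end KleinGordonTorus

theorem lemma3p3 (φ : KleinGordonTorus.Freq → ℝ) (hφ : KleinGordonTorus.IsCutoff φ)
    (M : ℕ) (hM : 10 ≤ M) :
    ∃ C : ℝ, 0 < C ∧ ∀ (R : ℝ) [Fact (0 < R)], 2 ≤ R → ∀ t : ℝ, 0 ≤ t →
      ∀ u : KleinGordonTorus.L2 R,
        eLpNorm (fun s : ℝ => KleinGordonTorus.normX φ M (KleinGordonTorus.flow s u)) 2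
            (volume.restrict (Set.Icc 0 t)) ≤
          ENNReal.ofReal (C * Real.log R * Real.sqrt (1 + t / R)) *
            KleinGordonTorus.normH (M + 2) u := by
  obtain ⟨C, hC, h⟩ := KleinGordonTorus.lintegral_normX_sq_le hφ M
  refine ⟨Real.sqrt C, Real.sqrt_pos.mpr hC, fun R _ hR t ht u => ?_⟩
  have hR0 : 0 < R := Fact.out
  have hlog : 0 < Real.log R := Real.log_pos (by linarith)
  rw [eLpNorm_eq_lintegral_rpow_enorm_toReal two_ne_zero ENNReal.ofNat_ne_top]
  simp only [enorm_eq_self, ENNReal.toReal_ofNat, ENNReal.rpow_two]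
  refine (ENNReal.rpow_le_rpow (h R hR t ht u) (by norm_num)).trans (le_of_eq ?_)
  rw [ENNReal.mul_rpow_of_nonneg _ _ (by norm_num),
    ENNReal.ofReal_rpow_of_nonneg (by positivity) (by norm_num), ← Real.sqrt_eq_rpow,
    Real.sqrt_mul (by positivity), Real.sqrt_mul hC.le, Real.sqrt_sq hlog.le]
  rfl
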